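/- An absolute-valued real algebra is a real vector space $A$ with a bilinear product (not necessarily associative, commutative or unital) and a norm such that $\|xy\|=\|x\|\,\|y\|$ for all $x,y\in A$. Write $(x,y,z)=(xy)z-x(yz)$, $x^1=x$, $x^2=xx$. For $p,q,r\in\{1,2\}$, $A$ satisfies $(x^p,x^q,x^r)=0$ if this holds for every $x\in A$. Isomorphisms are bijective linear maps preserving products. For norm-one quaternions $a,b\in\mathbb H$ let $\mathbb H(a,b)$, ${}^*\mathbb H(a,b)$, $\mathbb H^*(a,b)$, $\overset{*}{\mathbb H}(a,b)$ be the normed space $\mathbb H$ with the product $x\odot y$ equal to $axyb$, $\overline{x}ayb$, $axb\overline{y}$, $a\overline{x}\,\overline{y}b$, respectively; omitted parameters are $a=b=1$. Let $i$ be the first imaginary unit of $\mathbb H$ and $e^{i\alpha}=\cos\alpha+i\sin\alpha$. **Theorem.** (1) Let $A$ be a 4-dimensional absolute-valued real algebra. Then $A$ satisfies the identity on the left if and only if $A$ is isomorphic to one of the algebras on the right: - $(x,x,x)=0$: $\mathbb H,\ \overset{*}{\mathbb H}$; - $(x,x^2,x)=0$: $\mathbb H,\ \overset{*}{\mathbb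 H}$; - $(x,x,x^2)=0$: $\mathbb H,\ \mathbb H^*$; - $(x,x^2,x^2)=0$: $\mathbb H,\ \mathbb H^*,\ \mathbb H^*(1,i)$; - $(x^2,x,x)=0$: $\mathbb H,\ {}^*\mathbb H$; - $(x^2,x^2,x)=0$: $\mathbb H,\ {}^*\mathbb H,\ {}^*\mathbb H(i,1)$; - $(x^2,x,x^2)=0$: $\mathbb H,\ \overset{*}{\mathbb H}$, and ${}^*\mathbb H(1,e^{i\alpha}),\ \mathbb H^*(e^{i\alpha},1)$ with $\alpha\in[0,\pi)$; - $(x^2,x^2,x^2)=0$: $\mathbb H,\ \overset{*}{\mathbb H},\ {}^*\mathbb H(i,1),\ {}^*\mathbb H(i,i),\ \mathbb H^*(1,i),\ \mathbb H^*(i,i)$, and ${}^*\mathbb H(1,e^{i\alpha}),\ \mathbb H^*(e^{i\alpha},1)$ with $\alpha\in[0,\pi)$. (2) The algebras $\mathbb H,\ \overset{*}{\mathbb H},\ {}^*\mathbb H(i,1),\ {}^*\mathbb H(i,i),\ \mathbb H^*(1,i),\ \mathbb H^*(i,i)$ are pairwise non-isomorphic, and none of them is isomorphic to a member of the families ${}^*\mathbb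 H(1,e^{i\alpha})$, $\mathbb H^*(e^{i\alpha},1)$, $\alpha\in[0,\pi)$. No member of one family is isomorphic to a member of the other. For $\alpha,\beta\in[0,\pi)$, ${}^*\mathbb H(1,e^{i\alpha})\cong{}^*\mathbb H(1,e^{i\beta})$ if and only if $\beta=\alpha$ or $\beta=\pi-\alpha$, and likewise for $\mathbb H^*(e^{i\alpha},1)$ and $\mathbb H^*(e^{i\beta},1)$. (3) Let $N(p,q,r)$ be the number of isomorphism classes of 4-dimensional absolute-valued real algebras satisfying $(x^p,x^q,x^r)=0$. Then $N(1,1,1)=N(1,1,2)=N(1,2,1)=N(2,1,1)=2$, $N(1,2,2)=N(2,2,1)=3$, and $N(2,1,2)=N(2,2,2)=\infty$. -/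

import Mathlib

open scoped Quaternion

universe u v w

noncomputable section

/-- An absolute-valued real algebra: a real vector space with a bilinear (not necessarily
associative, commutative or unital) product and a multiplicative norm. -/
structure AbsoluteValuedAlgebra : Type (u + 1) where
  carrier : Type u
  [instNormedAddCommGroup : NormedAddCommGroup carrier]
  [instNormedSpace : NormedSpace ℝ carrier]
  /-- the product of the algebra -/
  mul : carrier →ₗ[ℝ] carrier →ₗ[ℝ] carrier
  norm_mul' : ∀ x y : carrier, ‖mul x y‖ = ‖x‖ * ‖y‖

namespace AbsoluteValuedAlgebra

instance : CoeSort AbsoluteValuedAlgebra.{u} (Type u) := ⟨carrier⟩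

attribute [instance] instNormedAddCommGroup instNormedSpace

/-- The associator `(x, y, z) = (x y) z - x (y z)`. -/
def associator (A : AbsoluteValuedAlgebra.{u}) (x y z : A) : A :=
  A.mul (A.mul x y) z - A.mul x (A.mul y z)

/-- The powers `x¹ = x`, `x² = x x`, and in general `xⁿ⁺¹ = xⁿ x` for `n ≥ 1`
(the value at the exponent `0` is a placeholder and is never used below). -/
def pow (A : AbsoluteValuedAlgebra.{u}) (x : A) : ℕ → A
  | 0 => 0
  | 1 => x
  | n + 2 => A.mul (A.pow x (n + 1)) x

/-- The algebra satisfies the identity `(x^p, x^q, x^r) = 0`. -/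
def Satisfies (A : AbsoluteValuedAlgebra.{u}) (p q r : ℕ) : Prop :=
  ∀ x : A, A.associator (A.pow x p) (A.pow x q) (A.pow x r) = 0

/-- Isomorphism of real algebras: a linear bijection that preserves products. -/
def Iso (A : AbsoluteValuedAlgebra.{u}) (B : AbsoluteValuedAlgebra.{v}) : Prop :=
  ∃ f : A ≃ₗ[ℝ] B, ∀ x y : A, f (A.mul x y) = B.mul (f x) (f y)

theorem Iso.refl (A : AbsoluteValuedAlgebra.{u}) : A.Iso A :=
  ⟨LinearEquiv.refl ℝ A, fun _ _ => rfl⟩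

theorem Iso.symm {A : AbsoluteValuedAlgebra.{u}} {B : AbsoluteValuedAlgebra.{v}}
    (h : A.Iso B) : B.Iso A := by
  obtain ⟨f, hf⟩ := h
  exact ⟨f.symm, fun x y => f.injective (by simp [hf])⟩

theorem Iso.trans {A : AbsoluteValuedAlgebra.{u}} {B : AbsoluteValuedAlgebra.{v}}
    {C : AbsoluteValuedAlgebra.{w}} (h : A.Iso B) (k : B.Iso C) : A.Iso C := by
  obtain ⟨f, hf⟩ := h
  obtain ⟨g, hg⟩ := k
  exact ⟨f.trans g, fun x y => by simp [hf, hg]⟩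

/-- The 4-dimensional absolute-valued real algebras that satisfy `(x^p, x^q, x^r) = 0`. -/
def FourDimSatisfying (p q r : ℕ) : Type (u + 1) :=
  {A : AbsoluteValuedAlgebra.{u} // Module.finrank ℝ A = 4 ∧ A.Satisfies p q r}

/-- Being isomorphic, as an equivalence relation. -/
def isoSetoid (p q r : ℕ) : Setoid (FourDimSatisfying.{u} p q r) where
  r A B := A.1.Iso B.1
  iseqv := ⟨fun A => Iso.refl A.1, fun h => h.symm, fun h k => h.trans k⟩

/-- The number `N(p,q,r)` of isomorphism classes of 4-dimensional absolute-valued real algebras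
satisfying `(x^p, x^q, x^r) = 0`, as an element of `ℕ ∪ {∞}`. -/
def numIsoClasses (p q r : ℕ) : ℕ∞ :=
  ENat.card (Quotient (isoSetoid.{u} p q r))

end AbsoluteValuedAlgebra

/-- The set `S(ℍ)` of norm-one quaternions (it carries Mathlib's group structure). -/
abbrev UnitQuaternion : Type := Metric.sphere (0 : ℍ[ℝ]) 1

theorem UnitQuaternion.norm_coeComplex (z : ℂ) : ‖(z : ℍ[ℝ])‖ = ‖z‖ := by
  rw [← sq_eq_sq₀ (norm_nonneg _) (norm_nonneg _), sq, ← Quaternion.normSq_eq_norm_mul_self,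
    Quaternion.normSq_def', ← Complex.normSq_eq_norm_sq, Complex.normSq_apply]
  simp
  ring

namespace PrincipalIsotope

open AbsoluteValuedAlgebra

/-- `ℍ(a,b)`: the normed space `ℍ` with the product `x ⊙ y = a x y b`. -/
def H (a b : UnitQuaternion) : AbsoluteValuedAlgebra.{0} where
  carrier := ℍ[ℝ]
  mul := LinearMap.mk₂ ℝ (fun x y : ℍ[ℝ] => (a : ℍ[ℝ]) * x * y * (b : ℍ[ℝ]))
    (fun x x' y => by simp only [mul_add, add_mul])
    (fun c x y => by simp only [mul_smul_comm, smul_mul_assoc])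
    (fun x y y' => by simp only [mul_add, add_mul])
    (fun c x y => by simp only [mul_smul_comm, smul_mul_assoc])
  norm_mul' x y := by simp

/-- `*ℍ(a,b)`: the normed space `ℍ` with the product `x ⊙ y = x̄ a y b`. -/
def starH (a b : UnitQuaternion) : AbsoluteValuedAlgebra.{0} where
  carrier := ℍ[ℝ]
  mul := LinearMap.mk₂ ℝ (fun x y : ℍ[ℝ] => star x * (a : ℍ[ℝ]) * y * (b : ℍ[ℝ]))
    (fun x x' y => by simp only [star_add, add_mul])
    (fun c x y => by simp only [Quaternion.star_smul, smul_mul_assoc])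
    (fun x y y' => by simp only [mul_add, add_mul])
    (fun c x y => by simp only [mul_smul_comm, smul_mul_assoc])
  norm_mul' x y := by simp

/-- `ℍ*(a,b)`: the normed space `ℍ` with the product `x ⊙ y = a x b ȳ`. -/
def Hstar (a b : UnitQuaternion) : AbsoluteValuedAlgebra.{0} where
  carrier := ℍ[ℝ]
  mul := LinearMap.mk₂ ℝ (fun x y : ℍ[ℝ] => (a : ℍ[ℝ]) * x * (b : ℍ[ℝ]) * star y)
    (fun x x' y => by simp only [mul_add, add_mul])
    (fun c x y => by simp only [mul_smul_comm, smul_mul_assoc])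
    (fun x y y' => by simp only [star_add, mul_add])
    (fun c x y => by simp only [Quaternion.star_smul, mul_smul_comm])
  norm_mul' x y := by simp

/-- The doubly-starred `ℍ(a,b)`: the normed space `ℍ` with the product `x ⊙ y = a x̄ ȳ b`. -/
def starHstar (a b : UnitQuaternion) : AbsoluteValuedAlgebra.{0} where
  carrier := ℍ[ℝ]
  mul := LinearMap.mk₂ ℝ (fun x y : ℍ[ℝ] => (a : ℍ[ℝ]) * star x * star y * (b : ℍ[ℝ]))
    (fun x x' y => by simp only [star_add, mul_add, add_mul])
    (fun c x y => by simp only [Quaternion.star_smul, mul_smul_comm, smul_mul_assoc])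
    (fun x y y' => by simp only [star_add, mul_add, add_mul])
    (fun c x y => by simp only [Quaternion.star_smul, mul_smul_comm, smul_mul_assoc])
  norm_mul' x y := by simp

/-- The norm-one quaternion `e^{iα} = cos α + i sin α`, in the copy `ℝ + ℝ i` of `ℂ` in `ℍ`. -/
def expI (α : ℝ) : UnitQuaternion :=
  ⟨((Complex.exp (α * Complex.I) : ℂ) : ℍ[ℝ]), by
    rw [mem_sphere_zero_iff_norm, UnitQuaternion.norm_coeComplex, Complex.norm_exp_ofReal_mul_I]⟩

/-- The first imaginary unit `i` of the canonical basis `1, i, j, k` of `ℍ`. -/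
def unitI : UnitQuaternion :=
  ⟨((Complex.I : ℂ) : ℍ[ℝ]), by
    rw [mem_sphere_zero_iff_norm, UnitQuaternion.norm_coeComplex, Complex.norm_I]⟩

end PrincipalIsotope

end

/-!
A four-dimensional absolute-valued algebra is an isotope of the quaternions, and the identities are
then polynomial equations in the parameters of the isotope.

*Reduction to `ℍ(a,b)`, `*ℍ(a,b)`, `ℍ*(a,b)` and the doubly starred `ℍ(a,b)`.* Left multiplication
by a unit vector is a linear isometry, hence preserves the unit ball and Haar measure; averaging the
square of a linear form over the ball therefore shows that the norm is Euclidean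
(`parallelogram_of_norm_mul`). Composing the product with the inverses of the two multiplications
by a unit vector `e` gives a unital algebra with multiplicative Euclidean norm, which is `ℍ`
(`exists_quaternion_isometry`). So the product is `φ(x) ψ(y)` with linear isometries `φ`, `ψ` of
`ℍ`. As reflections generate the orthogonal group, each of these is `x ↦ a x b` or `x ↦ a x̄ b`, and
translations absorb two of the four parameters (`iso_principalIsotope`).

*Solving the identities.* Simultaneous conjugation of the parameters and a change of their signs do
not change the isomorphism class, so one may take `a = c + s i`, `b = p + q i + r j`
(`NormalPosition`). Evaluating the identity at a few quaternions leaves only the parameters in the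
table. Passing to the opposite algebra reverses the exponents and exchanges `*ℍ` with `ℍ*`, which
roughly halves the work. For `ℍ(a,b)` and its doubly starred form every element is a square, so
there the identity in three squares reduces to `(x,x,x) = 0`. Conversely the listed algebras satisfy
the identities by direct computation: all squares in `*ℍ(1,b)` are multiples of the idempotent `b`,
and `x̄ i x` is purely imaginary.

*Non-isomorphism.* Most pairs are separated by one of the eight identities. The others are
separated by traces of left multiplications: that trace is always `0` in `*ℍ(i,i)` but not in
`ℍ*(i,i)`, and at the unique nonzero idempotent of `*ℍ(1,e^{iα})` it is `4 cos² α`, which determines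
`α` up to `α ↦ π - α`. Conjugation by `j` and a change of sign realise the latter isomorphism. The
two families are separated by the identity `(xy)(xz) = (xx)(yz)`.
-/

noncomputable section

/-! ### Identities, isomorphisms and opposite algebras -/

namespace AbsoluteValuedAlgebra

theorem satisfies_iff (A : AbsoluteValuedAlgebra.{u}) (p q r : ℕ) :
    A.Satisfies p q r ↔ ∀ x : A, A.mul (A.mul (A.pow x p) (A.pow x q)) (A.pow x r) =
      A.mul (A.pow x p) (A.mul (A.pow x q) (A.pow x r)) :=
  forall_congr' fun _ => sub_eq_zero

theorem map_pow {A : AbsoluteValuedAlgebra.{u}} {B : AbsoluteValuedAlgebra.{v}} (f : A ≃ₗ[ℝ] B)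
    (hf : ∀ x y : A, f (A.mul x y) = B.mul (f x) (f y)) (x : A) :
    ∀ n : ℕ, f (A.pow x n) = B.pow (f x) n
  | 0 => map_zero f
  | 1 => rfl
  | n + 2 => by rw [pow, hf, map_pow f hf x (n + 1)]; rfl

theorem Iso.satisfies {A : AbsoluteValuedAlgebra.{u}} {B : AbsoluteValuedAlgebra.{v}}
    (h : A.Iso B) {p q r : ℕ} (hA : A.Satisfies p q r) : B.Satisfies p q r := by
  obtain ⟨f, hf⟩ := h
  rw [satisfies_iff] at *
  intro y
  obtain ⟨x, rfl⟩ := f.surjective y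
  simpa only [hf, map_pow f hf] using congrArg f (hA x)

theorem Iso.satisfies_iff {A : AbsoluteValuedAlgebra.{u}} {B : AbsoluteValuedAlgebra.{v}}
    (h : A.Iso B) {p q r : ℕ} : A.Satisfies p q r ↔ B.Satisfies p q r :=
  ⟨h.satisfies, h.symm.satisfies⟩

/-- The opposite algebra, with product `(x, y) ↦ y x`. -/
def op (A : AbsoluteValuedAlgebra.{u}) : AbsoluteValuedAlgebra.{u} where
  carrier := A
  mul := A.mul.flip
  norm_mul' x y := by rw [LinearMap.flip_apply, A.norm_mul', mul_comm]

theorem Iso.op {A : AbsoluteValuedAlgebra.{u}} {B : AbsoluteValuedAlgebra.{v}}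
    (h : A.Iso B) : A.op.Iso B.op := by
  obtain ⟨f, hf⟩ := h
  exact ⟨f, fun x y => hf y x⟩

theorem op_iso_op_iff {A : AbsoluteValuedAlgebra.{u}} {B : AbsoluteValuedAlgebra.{v}} :
    A.op.Iso B.op ↔ A.Iso B :=
  ⟨fun h => h.op, fun h => h.op⟩

/-- Passing to the opposite algebra reverses the three exponents; only the exponents `1` and `2`
are covered, since higher powers of the opposite algebra are bracketed differently. -/
theorem op_satisfies (A : AbsoluteValuedAlgebra.{u}) {p q r : ℕ} (hp : p = 1 ∨ p = 2)
    (hq : q = 1 ∨ q = 2) (hr : r = 1 ∨ r = 2) : A.op.Satisfies p q r ↔ A.Satisfies r q p := by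
  have key : ∀ n : ℕ, n = 1 ∨ n = 2 → ∀ x : A, A.op.pow x n = A.pow x n := by
    rintro n (rfl | rfl) x <;> rfl
  rw [satisfies_iff, satisfies_iff]
  refine forall_congr' fun x => ?_
  rw [key p hp x, key q hq x, key r hr x]
  exact eq_comm

end AbsoluteValuedAlgebra

/-! ### Quaternions in coordinates -/

/-- The quaternion with the given coordinates in the basis `1, i, j, k`. -/
def quat (a b c d : ℝ) : ℍ[ℝ] := ⟨a, b, c, d⟩

namespace quat

@[simp] theorem re (a b c d : ℝ) : (quat a b c d).re = a := rfl
@[simp] theorem imI (a b c d : ℝ) : (quat a b c d).imI = b := rfl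
@[simp] theorem imJ (a b c d : ℝ) : (quat a b c d).imJ = c := rfl
@[simp] theorem imK (a b c d : ℝ) : (quat a b c d).imK = d := rfl

theorem mul (a b c d a' b' c' d' : ℝ) : quat a b c d * quat a' b' c' d' =
    quat (a * a' - b * b' - c * c' - d * d') (a * b' + b * a' + c * d' - d * c')
      (a * c' - b * d' + c * a' + d * b') (a * d' + b * c' - c * b' + d * a') := by
  ext <;> simp

theorem star (a b c d : ℝ) : Star.star (quat a b c d) = quat a (-b) (-c) (-d) := by
  ext <;> simp

theorem inj (a b c d a' b' c' d' : ℝ) :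
    quat a b c d = quat a' b' c' d' ↔ a = a' ∧ b = b' ∧ c = c' ∧ d = d' := by
  rw [Quaternion.ext_iff]; rfl

theorem eq_zero_iff (a b c d : ℝ) :
    quat a b c d = 0 ↔ a = 0 ∧ b = 0 ∧ c = 0 ∧ d = 0 :=
  inj a b c d 0 0 0 0

theorem sq_norm (a b c d : ℝ) : ‖quat a b c d‖ ^ 2 = a ^ 2 + b ^ 2 + c ^ 2 + d ^ 2 := by
  rw [sq, ← Quaternion.normSq_eq_norm_mul_self, Quaternion.normSq_def']; rfl

end quat

/-! ### Unit quaternions -/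

theorem UnitQuaternion.star_coe (p : UnitQuaternion) : star (p : ℍ[ℝ]) = (p : ℍ[ℝ])⁻¹ := by
  rw [Quaternion.inv_def, Quaternion.normSq_eq_norm_mul_self, norm_eq_of_mem_sphere]
  simp

theorem UnitQuaternion.coe_ne_zero (p : UnitQuaternion) : (p : ℍ[ℝ]) ≠ 0 :=
  ne_zero_of_mem_unit_sphere p

@[simp] theorem UnitQuaternion.inv_mul_cancel_left (p : UnitQuaternion) (x : ℍ[ℝ]) :
    (p : ℍ[ℝ])⁻¹ * (p * x) = x := inv_mul_cancel_left₀ p.coe_ne_zero x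

@[simp] theorem UnitQuaternion.mul_inv_cancel_left (p : UnitQuaternion) (x : ℍ[ℝ]) :
    (p : ℍ[ℝ]) * ((p : ℍ[ℝ])⁻¹ * x) = x := mul_inv_cancel_left₀ p.coe_ne_zero x

@[simp] theorem UnitQuaternion.mul_inv_cancel (p : UnitQuaternion) :
    (p : ℍ[ℝ]) * (p : ℍ[ℝ])⁻¹ = 1 := mul_inv_cancel₀ p.coe_ne_zero

@[simp] theorem UnitQuaternion.inv_mul_cancel (p : UnitQuaternion) :
    (p : ℍ[ℝ])⁻¹ * (p : ℍ[ℝ]) = 1 := inv_mul_cancel₀ p.coe_ne_zero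

/-- Every nonzero quaternion can be scaled to a unit quaternion without changing an
intertwining relation. -/
theorem UnitQuaternion.exists_of_intertwine {x : ℍ[ℝ]} (hx : x ≠ 0) :
    ∃ p : UnitQuaternion, ∀ y z : ℍ[ℝ], x * y = z * x → (p : ℍ[ℝ]) * y = z * p := by
  refine ⟨⟨‖x‖⁻¹ • x, by simp [norm_smul, hx]⟩, fun y z h => ?_⟩
  simp only [smul_mul_assoc, mul_smul_comm, h]

/-! ### The identities for parameters in normal position -/

namespace PrincipalIsotope
open AbsoluteValuedAlgebra

/-- The pair `(a, b)` has the form `a = c + s i`, `b = p + q i + r j`. Conjugation by a unit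
quaternion brings every pair of unit quaternions into this position. -/
structure NormalPosition (a b : UnitQuaternion) (c s p q r : ℝ) : Prop where
  left : (a : ℍ[ℝ]) = quat c s 0 0
  right : (b : ℍ[ℝ]) = quat p q r 0

theorem NormalPosition.sq_add_sq_left {a b : UnitQuaternion} {c s p q r : ℝ}
    (N : NormalPosition a b c s p q r) : c ^ 2 + s ^ 2 = 1 := by
  have h := quat.sq_norm c s 0 0
  rw [← N.left, norm_eq_of_mem_sphere] at h
  linarith

theorem NormalPosition.sq_add_sq_right {a b : UnitQuaternion} {c s p q r : ℝ}
    (N : NormalPosition a b c s p q r) : p ^ 2 + q ^ 2 + r ^ 2 = 1 := by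
  have h := quat.sq_norm p q r 0
  rw [← N.right, norm_eq_of_mem_sphere] at h
  linarith

variable {a b : UnitQuaternion} {c s p q r : ℝ}

/-- Evaluating an identity at one quaternion gives four polynomial equations in `c, s, p, q, r`.
Here and in the following lemmas a few evaluation points with small integer coordinates suffice:
together with `c² + s² = 1` and `p² + q² + r² = 1` their equations force the conclusion. Where the
elimination is done in stages, only the equations that a stage needs are kept in the context. -/
theorem H_satisfies_111_of_normal (N : NormalPosition a b c s p q r)
    (h : (H a b).Satisfies 1 1 1) : s = 0 ∧ q = 0 ∧ r = 0 := by
  have hc := N.sq_add_sq_left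
  have hp := N.sq_add_sq_right
  have E : ∀ x : ℍ[ℝ], a * (a * x * x * b) * x * b =
      a * x * (a * x * x * b) * b := (satisfies_iff _ _ _ _).1 h
  simp only [N.left, N.right] at E
  clear h N
  have h0 := E (quat 1 0 0 0)
  have h1 := E (quat 0 1 0 0)
  have h2 := E (quat 0 0 1 0)
  have h3 := E (quat 1 1 1 0)
  clear E
  simp [quat.mul, quat.inj] at h0 h1 h2 h3
  grind

theorem H_satisfies_112_of_normal (N : NormalPosition a b c s p q r)
    (h : (H a b).Satisfies 1 1 2) : s = 0 ∧ q = 0 ∧ r = 0 := by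
  have hc := N.sq_add_sq_left
  have hp := N.sq_add_sq_right
  have E : ∀ x : ℍ[ℝ], a * (a * x * x * b) * (a * x * x * b) * b =
      a * x * (a * x * (a * x * x * b) * b) * b := (satisfies_iff _ _ _ _).1 h
  simp only [N.left, N.right] at E
  clear h N
  have h0 := E (quat 1 0 0 0)
  have h1 := E (quat 0 0 1 0)
  have h2 := E (quat 1 1 0 0)
  have h3 := E (quat 1 0 1 0)
  clear E
  simp [quat.mul, quat.inj] at h0 h1 h2 h3
  have : s * r = 0 := by
    clear h1 h2 h3
    grind
  have : s = 0 := by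
    clear h0 h2 h3
    grind
  clear h0 h1
  grind

theorem H_satisfies_121_of_normal (N : NormalPosition a b c s p q r)
    (h : (H a b).Satisfies 1 2 1) : s = 0 ∧ q = 0 ∧ r = 0 := by
  have hc := N.sq_add_sq_left
  have hp := N.sq_add_sq_right
  have E : ∀ x : ℍ[ℝ], a * (a * x * (a * x * x * b) * b) * x * b =
      a * x * (a * (a * x * x * b) * x * b) * b := (satisfies_iff _ _ _ _).1 h
  simp only [N.left, N.right] at E
  clear h N
  have h0 := E (quat 1 0 0 0)
  have h1 := E (quat 0 1 0 0)
  have h2 := E (quat 0 0 1 0)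
  have h3 := E (quat 1 1 0 0)
  have h4 := E (quat 1 0 1 0)
  have h5 := E (quat 1 1 1 0)
  clear E
  simp [quat.mul, quat.inj] at h0 h1 h2 h3 h4 h5
  grind

theorem H_satisfies_122_of_normal (N : NormalPosition a b c s p q r)
    (h : (H a b).Satisfies 1 2 2) : s = 0 ∧ q = 0 ∧ r = 0 := by
  have hc := N.sq_add_sq_left
  have hp := N.sq_add_sq_right
  have E : ∀ x : ℍ[ℝ], a * (a * x * (a * x * x * b) * b) * (a * x * x * b) * b =
      a * x * (a * (a * x * x * b) * (a * x * x * b) * b) * b := (satisfies_iff _ _ _ _).1 h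
  simp only [N.left, N.right] at E
  clear h N
  have h0 := E (quat 1 0 0 0)
  have h1 := E (quat 0 0 1 0)
  have h2 := E (quat 1 0 1 0)
  have h3 := E (quat 1 1 1 0)
  clear E
  simp [quat.mul, quat.inj] at h0 h1 h2 h3
  have : s * r = 0 := by
    clear h1 h2 h3
    grind
  have : s = 0 := by
    clear h0 h2 h3
    grind
  clear h0 h1
  subst this
  have hc' : c = 1 ∨ c = -1 := by grind
  rcases hc' with rfl | rfl <;> simp at h2 h3 <;> grind

theorem H_satisfies_212_of_normal (N : NormalPosition a b c s p q r)
    (h : (H a b).Satisfies 2 1 2) : s = 0 ∧ q = 0 ∧ r = 0 := by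
  have hc := N.sq_add_sq_left
  have hp := N.sq_add_sq_right
  have ha0 := a.coe_ne_zero
  have hb0 := b.coe_ne_zero
  have E : ∀ x : ℍ[ℝ], a * (a * (a * x * x * b) * x * b) * (a * x * x * b) * b =
      a * (a * x * x * b) * (a * x * (a * x * x * b) * b) * b := (satisfies_iff _ _ _ _).1 h
  -- cancelling the outer unit factors lowers the degree in `c, s, p, q, r`
  have E : ∀ x : ℍ[ℝ], a * x * x * b * x * b * a * x * x =
      x * x * b * a * x * a * x * x * b := fun x => by
    refine mul_left_cancel₀ (a := (a * a : ℍ[ℝ])) (by simp [ha0])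
      (mul_right_cancel₀ (b := (b * b : ℍ[ℝ])) (by simp [hb0]) ?_)
    simpa only [mul_assoc, star_mul, star_star] using E x
  simp only [N.left, N.right] at E
  clear h N ha0 hb0
  have h0 := E (quat 1 0 0 0)
  have h1 := E (quat 0 1 0 0)
  have h2 := E (quat 0 0 1 0)
  have h3 := E (quat 1 0 1 0)
  have h4 := E (quat 1 1 1 0)
  clear E
  simp [quat.mul, quat.inj] at h0 h1 h2 h3 h4
  have g1 : s * r * (c * q + s * p) = 0 ∧ s * r * c = 0 := by
    clear h1 h2 h3 h4
    grind
  have g2 : s * r * q = 0 := by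
    clear h3 h4
    grind
  have g3 : s * r = 0 := by
    by_contra h
    obtain rfl : c = 0 := by simpa [h] using g1.2
    obtain rfl : q = 0 := by simpa [h] using g2
    obtain rfl : p = 0 := by simpa [h, left_ne_zero_of_mul h] using g1.1
    clear h0 h1 h2 h4
    grind
  clear h0 h1 h2
  rcases mul_eq_zero.1 g3 with rfl | rfl
  · clear g1 g2 g3
    grind
  · rcases eq_or_ne s 0 with hs | hs <;> grind

theorem starH_satisfies_212_of_normal (N : NormalPosition a b c s p q r)
    (h : (starH a b).Satisfies 2 1 2) : s = 0 := by
  have hc := N.sq_add_sq_left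
  have hp := N.sq_add_sq_right
  have ha0 := a.coe_ne_zero
  have hb0 := b.coe_ne_zero
  have E : ∀ x : ℍ[ℝ], star (star (star x * a * x * b) * a * x * b) * a * (star x * a * x * b) *
      b =
      star (star x * a * x * b) * a * (star x * a * (star x * a * x * b) * b) *
        b := (satisfies_iff _ _ _ _).1 h
  -- for `x ≠ 0` the outer factors cancel, including `x̄`
  have E : ∀ x : ℍ[ℝ], x ≠ 0 → star x * a * x * b * a * star x * a * x =
      x * a * star x * a * star x * a * x * b := fun x hx => by
    refine mul_left_cancel₀ (a := star (b : ℍ[ℝ]) * star x * star (a : ℍ[ℝ]))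
      (by simp [ha0, hb0, hx])
      (mul_right_cancel₀ (b := (b * b : ℍ[ℝ])) (by simp [hb0]) ?_)
    simpa only [mul_assoc, star_mul, star_star] using E x
  simp only [N.left, N.right] at E
  clear h N ha0 hb0
  have h0 := E (quat 1 0 0 0) (by simp [quat.eq_zero_iff])
  have h1 := E (quat 1 0 1 0) (by simp [quat.eq_zero_iff])
  have h2 := E (quat 2 1 1 0) (by simp [quat.eq_zero_iff])
  clear E
  simp [quat.mul, quat.star, quat.inj] at h0 h1 h2
  have g1 : r = 0 ∨ c = 0 ∨ s = 0 := by
    clear h1 h2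
    grind
  by_contra hs
  have g2 : r = 0 := by
    by_contra h
    obtain rfl : c = 0 := by simpa [h, hs] using g1
    clear h0 h2
    grind
  subst g2
  obtain ⟨rfl, rfl⟩ : p = 0 ∧ c = 0 := by
    clear h0 h2
    grind
  clear h0 h1
  grind

theorem starH_satisfies_222_of_normal (N : NormalPosition a b c s p q r)
    (h : (starH a b).Satisfies 2 2 2) : s = 0 ∨ (c = 0 ∧ r = 0 ∧ p * q = 0) := by
  have hc := N.sq_add_sq_left
  have hp := N.sq_add_sq_right
  have ha0 := a.coe_ne_zero
  have hb0 := b.coe_ne_zero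
  have E : ∀ x : ℍ[ℝ], star (star (star x * a * x * b) * a * (star x * a * x * b) * b) * a *
      (star x * a * x * b) * b =
      star (star x * a * x * b) * a * (star (star x * a * x * b) * a * (star x * a * x * b) * b) *
        b := (satisfies_iff _ _ _ _).1 h
  -- expanding the conjugates and cancelling the outer unit factors lowers the degree
  have E : ∀ x : ℍ[ℝ], star (b : ℍ[ℝ]) * (star x * star (a : ℍ[ℝ]) * x) * star (a : ℍ[ℝ]) *
      (star x * a * x) * b * a * (star x * a * x) =
      star x * star (a : ℍ[ℝ]) * x * a * star (b : ℍ[ℝ]) * (star x * star (a : ℍ[ℝ]) * x) * a *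
        (star x * a * x) * b := fun x => by
    refine mul_left_cancel₀ (a := star (b : ℍ[ℝ])) (by simp [hb0])
      (mul_right_cancel₀ (b := (b * b : ℍ[ℝ])) (by simp [hb0]) ?_)
    simpa only [mul_assoc, star_mul, star_star] using E x
  simp only [N.left, N.right] at E
  clear h N ha0 hb0
  have h0 := E (quat 1 0 0 0)
  have h1 := E (quat 0 0 1 0)
  have h2 := E (quat 1 0 1 0)
  have h3 := E (quat 1 0 0 1)
  have h4 := E (quat 2 1 1 0)
  have h5 := E (quat 0 2 1 1)
  clear E
  simp [quat.mul, quat.star, quat.inj] at h0 h1 h2 h3 h4 h5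
  have g1 : r * (c * s) = 0 := by
    clear h1 h2 h3 h4 h5
    grind
  have g2 : c * s = 0 := by
    rcases mul_eq_zero.1 g1 with rfl | h
    · clear h0 h2 h3 h4 h5
      grind
    · exact h
  rcases mul_eq_zero.1 g2 with rfl | h
  swap
  · exact Or.inl h
  have hs : s = 1 ∨ s = -1 := by grind
  right
  have g3 : p * r = 0 := by
    clear h0 h1 h2 h4 h5
    rcases hs with rfl | rfl <;> grind
  have g4 : q * r = 0 := by
    clear h0 h1 h3 h4 h5
    rcases hs with rfl | rfl <;> grind
  obtain rfl : r = 0 := by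
    clear h0 h1 h2 h3
    rcases hs with rfl | rfl <;> grind
  have g6 : p * q = 0 := by
    clear h0 h1 h2 h3
    rcases hs with rfl | rfl <;> grind
  simpa using g6

theorem not_starH_satisfies_111_of_normal (N : NormalPosition a b c s p q r)
    (h : (starH a b).Satisfies 1 1 1) : False := by
  have hc := N.sq_add_sq_left
  have hp := N.sq_add_sq_right
  have E : ∀ x : ℍ[ℝ], star (star x * a * x * b) * a * x * b =
      star x * a * (star x * a * x * b) * b := (satisfies_iff _ _ _ _).1 h
  simp only [N.left, N.right] at E
  clear h N
  have h0 := E (quat 1 0 0 0)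
  have h1 := E (quat 0 1 0 0)
  have h2 := E (quat 0 0 1 0)
  clear E
  simp [quat.mul, quat.star, quat.inj] at h0 h1 h2
  grind

theorem not_starH_satisfies_112_of_normal (N : NormalPosition a b c s p q r)
    (h : (starH a b).Satisfies 1 1 2) : False := by
  have hc := N.sq_add_sq_left
  have hp := N.sq_add_sq_right
  have E : ∀ x : ℍ[ℝ], star (star x * a * x * b) * a * (star x * a * x * b) * b =
      star x * a * (star x * a * (star x * a * x * b) * b) * b := (satisfies_iff _ _ _ _).1 h
  simp only [N.left, N.right] at E
  clear h N
  have h0 := E (quat 1 0 0 0)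
  have h1 := E (quat 0 1 0 0)
  have h2 := E (quat 0 0 1 0)
  clear E
  simp [quat.mul, quat.star, quat.inj] at h0 h1 h2
  grind

theorem not_starH_satisfies_121_of_normal (N : NormalPosition a b c s p q r)
    (h : (starH a b).Satisfies 1 2 1) : False := by
  have hc := N.sq_add_sq_left
  have hp := N.sq_add_sq_right
  have E : ∀ x : ℍ[ℝ], star (star x * a * (star x * a * x * b) * b) * a * x * b =
      star x * a * (star (star x * a * x * b) * a * x * b) * b := (satisfies_iff _ _ _ _).1 h
  simp only [N.left, N.right] at E
  clear h N
  have h0 := E (quat 1 0 0 0)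
  have h1 := E (quat 0 1 0 0)
  have h2 := E (quat 1 1 0 0)
  have h3 := E (quat 0 0 1 0)
  clear E
  simp [quat.mul, quat.star, quat.inj] at h0 h1 h2 h3
  grind

theorem not_starH_satisfies_122_of_normal (N : NormalPosition a b c s p q r)
    (h : (starH a b).Satisfies 1 2 2) : False := by
  have hc := N.sq_add_sq_left
  have hp := N.sq_add_sq_right
  have E : ∀ x : ℍ[ℝ], star (star x * a * (star x * a * x * b) * b) * a * (star x * a * x * b) *
      b =
      star x * a * (star (star x * a * x * b) * a * (star x * a * x * b) * b) *
        b := (satisfies_iff _ _ _ _).1 h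
  simp only [N.left, N.right] at E
  clear h N
  have h0 := E (quat 1 0 0 0)
  have h1 := E (quat 0 1 0 0)
  have h2 := E (quat 1 1 0 0)
  have h3 := E (quat 0 0 1 0)
  clear E
  simp [quat.mul, quat.star, quat.inj] at h0 h1 h2 h3
  grind

theorem starH_satisfies_211_of_normal (N : NormalPosition a b c s p q r)
    (h : (starH a b).Satisfies 2 1 1) : s = 0 ∧ q = 0 ∧ r = 0 := by
  have hc := N.sq_add_sq_left
  have hp := N.sq_add_sq_right
  have E : ∀ x : ℍ[ℝ], star (star (star x * a * x * b) * a * x * b) * a * x * b =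
      star (star x * a * x * b) * a * (star x * a * x * b) * b := (satisfies_iff _ _ _ _).1 h
  simp only [N.left, N.right] at E
  clear h N
  have h0 := E (quat 1 0 0 0)
  have h1 := E (quat 0 1 0 0)
  have h2 := E (quat 0 0 1 0)
  have h3 := E (quat 1 0 1 0)
  clear E
  simp [quat.mul, quat.star, quat.inj] at h0 h1 h2 h3
  grind

theorem starH_satisfies_221_of_normal (N : NormalPosition a b c s p q r)
    (h : (starH a b).Satisfies 2 2 1) : q = 0 ∧ r = 0 ∧ c * s = 0 := by
  have hc := N.sq_add_sq_left
  have hp := N.sq_add_sq_right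
  have E : ∀ x : ℍ[ℝ], star (star (star x * a * x * b) * a * (star x * a * x * b) * b) * a * x *
      b =
      star (star x * a * x * b) * a * (star (star x * a * x * b) * a * x * b) *
        b := (satisfies_iff _ _ _ _).1 h
  simp only [N.left, N.right] at E
  clear h N
  have h0 := E (quat 1 0 0 0)
  have h1 := E (quat 0 1 0 0)
  have h2 := E (quat 0 0 1 0)
  have h3 := E (quat 1 0 1 0)
  clear E
  simp [quat.mul, quat.star, quat.inj] at h0 h1 h2 h3
  have : r = 0 := by
    clear h2 h3
    grind
  have : (c ^ 2 - s ^ 2) ^ 2 - (2 * c * s) ^ 2 = p ^ 2 - q ^ 2 ∧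
      (c ^ 2 - s ^ 2) * (c * s) * 2 = p * q := by
    clear h0 h1 h3
    grind
  have : c * s = 0 := by
    clear h0 h1 h2
    grind
  clear h0 h1 h2 h3
  grind

theorem starHstar_satisfies_111_of_normal (N : NormalPosition a b c s p q r)
    (h : (starHstar a b).Satisfies 1 1 1) : s = 0 ∧ q = 0 ∧ r = 0 := by
  have hc := N.sq_add_sq_left
  have hp := N.sq_add_sq_right
  have E : ∀ x : ℍ[ℝ], a * star (a * star x * star x * b) * star x * b =
      a * star x * star (a * star x * star x * b) * b := (satisfies_iff _ _ _ _).1 h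
  simp only [N.left, N.right] at E
  clear h N
  have h0 := E (quat 1 0 0 0)
  have h1 := E (quat 0 1 0 0)
  have h2 := E (quat 0 0 1 0)
  have h3 := E (quat 1 1 1 0)
  clear E
  simp [quat.mul, quat.star, quat.inj] at h0 h1 h2 h3
  grind

theorem not_starHstar_satisfies_112_of_normal (N : NormalPosition a b c s p q r)
    (h : (starHstar a b).Satisfies 1 1 2) : False := by
  have hc := N.sq_add_sq_left
  have hp := N.sq_add_sq_right
  have E : ∀ x : ℍ[ℝ], a * star (a * star x * star x * b) * star (a * star x * star x * b) * b =
      a * star x * star (a * star x * star (a * star x * star x * b) * b) *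
        b := (satisfies_iff _ _ _ _).1 h
  simp only [N.left, N.right] at E
  clear h N
  have h0 := E (quat 1 0 0 0)
  have h1 := E (quat 0 1 0 0)
  have h2 := E (quat 1 1 0 0)
  have h3 := E (quat 0 0 1 0)
  clear E
  simp [quat.mul, quat.star, quat.inj] at h0 h1 h2 h3
  grind

theorem starHstar_satisfies_121_of_normal (N : NormalPosition a b c s p q r)
    (h : (starHstar a b).Satisfies 1 2 1) : s = 0 ∧ q = 0 ∧ r = 0 := by
  have hc := N.sq_add_sq_left
  have hp := N.sq_add_sq_right
  have E : ∀ x : ℍ[ℝ], a * star (a * star x * star (a * star x * star x * b) * b) * star x * b =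
      a * star x * star (a * star (a * star x * star x * b) * star x * b) *
        b := (satisfies_iff _ _ _ _).1 h
  simp only [N.left, N.right] at E
  clear h N
  have h0 := E (quat 1 0 0 0)
  have h1 := E (quat 0 1 0 0)
  have h2 := E (quat 0 0 1 0)
  have h3 := E (quat 1 0 1 0)
  have h4 := E (quat 1 1 1 0)
  clear E
  simp [quat.mul, quat.star, quat.inj] at h0 h1 h2 h3 h4
  grind

theorem not_starHstar_satisfies_122_of_normal (N : NormalPosition a b c s p q r)
    (h : (starHstar a b).Satisfies 1 2 2) : False := by
  have hc := N.sq_add_sq_left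
  have hp := N.sq_add_sq_right
  have E : ∀ x : ℍ[ℝ], a * star (a * star x * star (a * star x * star x * b) * b) *
      star (a * star x * star x * b) * b =
      a * star x * star (a * star (a * star x * star x * b) * star (a * star x * star x * b) *
        b) * b := (satisfies_iff _ _ _ _).1 h
  simp only [N.left, N.right] at E
  clear h N
  have h0 := E (quat 1 0 0 0)
  have h1 := E (quat 0 1 0 0)
  have h2 := E (quat 1 1 0 0)
  have h3 := E (quat 0 0 1 0)
  clear E
  simp [quat.mul, quat.star, quat.inj] at h0 h1 h2 h3
  grind

theorem starHstar_satisfies_212_of_normal (N : NormalPosition a b c s p q r)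
    (h : (starHstar a b).Satisfies 2 1 2) : s = 0 ∧ q = 0 ∧ r = 0 := by
  have hc := N.sq_add_sq_left
  have hp := N.sq_add_sq_right
  have ha0 := a.coe_ne_zero
  have hb0 := b.coe_ne_zero
  have E : ∀ x : ℍ[ℝ], a * star (a * star (a * star x * star x * b) * star x * b) *
      star (a * star x * star x * b) * b =
      a * star (a * star x * star x * b) * star (a * star x * star (a * star x * star x * b) *
        b) * b := (satisfies_iff _ _ _ _).1 h
  -- cancelling the outer unit factors lowers the degree in `c, s, p, q, r`
  have E : ∀ x : ℍ[ℝ], x * a * star x * star x * b * star (a : ℍ[ℝ]) * star (b : ℍ[ℝ]) * x * x =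
      x * x * star (a : ℍ[ℝ]) * star (b : ℍ[ℝ]) * a * star x * star x * b * x := fun x => by
    refine mul_left_cancel₀ (a := (a : ℍ[ℝ]) * star (b : ℍ[ℝ])) (by simp [ha0, hb0])
      (mul_right_cancel₀ (b := star (a : ℍ[ℝ]) * b) (by simp [ha0, hb0]) ?_)
    simpa only [mul_assoc, star_mul, star_star] using E x
  simp only [N.left, N.right] at E
  clear h N ha0 hb0
  have h0 := E (quat 1 0 0 0)
  have h1 := E (quat 0 1 0 0)
  have h2 := E (quat 0 0 1 0)
  have h3 := E (quat 1 0 1 0)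
  have h4 := E (quat 1 1 1 0)
  clear E
  simp [quat.mul, quat.star, quat.inj] at h0 h1 h2 h3 h4
  grind

end PrincipalIsotope

/-! ### Normal position by conjugation -/

namespace PrincipalIsotope
open AbsoluteValuedAlgebra

theorem coe_expI (α : ℝ) : (expI α : ℍ[ℝ]) = quat (Real.cos α) (Real.sin α) 0 0 := by
  ext <;> simp [expI, Complex.exp_ofReal_mul_I_re, Complex.exp_ofReal_mul_I_im]

theorem coe_unitI : (unitI : ℍ[ℝ]) = quat 0 1 0 0 := by
  ext <;> simp [unitI]

/-- Conjugation moves a quaternion into the closed upper half of the plane `ℝ + ℝ i`. -/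
theorem exists_conj_complex (x : ℍ[ℝ]) : ∃ (p : UnitQuaternion) (c s : ℝ), 0 ≤ s ∧
    (p : ℍ[ℝ]) * x = quat c s 0 0 * p := by
  obtain ⟨t, u, v, w⟩ := x
  change ∃ (p : UnitQuaternion) (c s : ℝ), 0 ≤ s ∧ (p : ℍ[ℝ]) * quat t u v w = quat c s 0 0 * p
  set n := √(u ^ 2 + v ^ 2 + w ^ 2) with hn
  have hn0 : 0 ≤ n := Real.sqrt_nonneg _
  have hn2 : n ^ 2 = u ^ 2 + v ^ 2 + w ^ 2 := Real.sq_sqrt (by positivity)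
  by_cases h : n + u = 0 ∧ v = 0 ∧ w = 0
  · obtain ⟨h, rfl, rfl⟩ := h
    -- the vector part is `-n i`, and conjugation by `j` reverses it
    obtain ⟨p, hp⟩ := UnitQuaternion.exists_of_intertwine (x := quat 0 0 1 0)
      (by simp [quat.eq_zero_iff])
    refine ⟨p, t, n, hn0, hp _ _ ?_⟩
    simp only [quat.mul, quat.inj]
    refine ⟨?_, ?_, ?_, ?_⟩ <;> linarith
  · -- `n - i (u i + v j + w k)` intertwines the imaginary part with `n i`
    obtain ⟨p, hp⟩ := UnitQuaternion.exists_of_intertwine (x := quat (n + u) 0 w (-v))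
      (by simp only [ne_eq, quat.eq_zero_iff, neg_eq_zero]; tauto)
    refine ⟨p, t, n, hn0, hp _ _ ?_⟩
    simp only [quat.mul, quat.inj]
    refine ⟨?_, ?_, ?_, ?_⟩ <;> linarith

/-- A rotation about `i` moves a quaternion into `ℝ + ℝ i + ℝ j`. -/
theorem exists_conj_kill_k (x : ℍ[ℝ]) : ∃ (e : UnitQuaternion) (p q r : ℝ),
    (e : ℍ[ℝ]) * x = quat p q r 0 * e ∧
      ∀ c s : ℝ, (e : ℍ[ℝ]) * quat c s 0 0 = quat c s 0 0 * e := by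
  obtain ⟨t, u, v, w⟩ := x
  change ∃ (e : UnitQuaternion) (p q r : ℝ), (e : ℍ[ℝ]) * quat t u v w = quat p q r 0 * e ∧ _
  set m := √(v ^ 2 + w ^ 2) with hm
  have hm2 : m ^ 2 = v ^ 2 + w ^ 2 := Real.sq_sqrt (by positivity)
  by_cases h : w = 0
  · exact ⟨1, t, u, v, by simp [h], by simp⟩
  · -- `(m + v) - w i` commutes with `i` and intertwines `v j + w k` with `m j`
    obtain ⟨e, he⟩ := UnitQuaternion.exists_of_intertwine (x := quat (m + v) (-w) 0 0)
      (by simp [quat.eq_zero_iff, h])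
    refine ⟨e, t, u, m, he _ _ ?_, fun c s => he _ _ ?_⟩ <;> simp only [quat.mul, quat.inj] <;>
      refine ⟨?_, ?_, ?_, ?_⟩ <;> linarith

/-- Simultaneous conjugation brings two unit quaternions into normal position. -/
theorem exists_normalPosition (a b : UnitQuaternion) : ∃ (g : UnitQuaternion) (c s p q r : ℝ),
    NormalPosition (g * a * g⁻¹) (g * b * g⁻¹) c s p q r := by
  obtain ⟨f, c, s, -, hf⟩ := exists_conj_complex a
  obtain ⟨e, p, q, r, he, he'⟩ := exists_conj_kill_k (f * b * f⁻¹)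
  refine ⟨e * f, c, s, p, q, r, ?_, ?_⟩
  · have key : (e : ℍ[ℝ]) * (f * a) = quat c s 0 0 * (e * f) := by
      rw [hf, ← mul_assoc, he', mul_assoc]
    calc _ = (e : ℍ[ℝ]) * (f * a) * ((f : ℍ[ℝ])⁻¹ * (e : ℍ[ℝ])⁻¹) := by simp [mul_assoc]
      _ = _ := by rw [key]; simp [mul_assoc]
  · calc _ = (e : ℍ[ℝ]) * (f * b * (f : ℍ[ℝ])⁻¹) * (e : ℍ[ℝ])⁻¹ := by simp [mul_assoc]
      _ = _ := by
        rw [← Metric.unitSphere.coe_inv f, he]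
        simp [mul_assoc]

/-! ### Isomorphisms between principal isotopes -/

/-- The linear bijection `x ↦ p x q` of the quaternions. -/
def sandwich (p q : UnitQuaternion) : ℍ[ℝ] ≃ₗ[ℝ] ℍ[ℝ] where
  toFun x := p * x * q
  invFun x := (p : ℍ[ℝ])⁻¹ * x * (q : ℍ[ℝ])⁻¹
  map_add' x y := by simp only [mul_add, add_mul]
  map_smul' c x := by simp
  left_inv x := by simp [mul_assoc]
  right_inv x := by simp [mul_assoc]

theorem sandwich_apply (p q : UnitQuaternion) (x : ℍ[ℝ]) : sandwich p q x = p * x * q := rfl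

/-- Conjugation `x ↦ x̄` as a linear bijection. -/
def conjEquiv : ℍ[ℝ] ≃ₗ[ℝ] ℍ[ℝ] where
  toFun x := star x
  invFun x := star x
  map_add' x y := star_add x y
  map_smul' c x := Quaternion.star_smul c x
  left_inv x := star_star x
  right_inv x := star_star x

theorem conjEquiv_apply (x : ℍ[ℝ]) : conjEquiv x = star x := rfl

section Conjugation
variable (a b g : UnitQuaternion)

theorem H_iso_conj : (H a b).Iso (H (g * a * g⁻¹) (g * b * g⁻¹)) :=
  ⟨sandwich g g⁻¹, fun (x y : ℍ[ℝ]) => show sandwich g g⁻¹ (_ * x * y * _) =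
    _ * (sandwich g g⁻¹ x) * (sandwich g g⁻¹ y) * _ by simp [sandwich_apply, mul_assoc]⟩

theorem starH_iso_conj : (starH a b).Iso (starH (g * a * g⁻¹) (g * b * g⁻¹)) :=
  ⟨sandwich g g⁻¹, fun (x y : ℍ[ℝ]) => show sandwich g g⁻¹ (star x * a * y * _) =
    star (sandwich g g⁻¹ x) * _ * (sandwich g g⁻¹ y) * _ by
      simp [sandwich_apply, mul_assoc, UnitQuaternion.star_coe]⟩

theorem starHstar_iso_conj : (starHstar a b).Iso (starHstar (g * a * g⁻¹) (g * b * g⁻¹)) :=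
  ⟨sandwich g g⁻¹, fun (x y : ℍ[ℝ]) => show sandwich g g⁻¹ (a * star x * star y * _) =
    _ * star (sandwich g g⁻¹ x) * star (sandwich g g⁻¹ y) * _ by
      simp [sandwich_apply, mul_assoc, UnitQuaternion.star_coe]⟩

/-- Here and below, changing the sign of a parameter is undone by the isomorphism `x ↦ -x`. -/
theorem H_iso_neg_left : (H a b).Iso (H (-a) b) :=
  ⟨sandwich (-1) 1, fun (x y : ℍ[ℝ]) => show sandwich (-1) 1 (a * x * y * _) =
    _ * (sandwich (-1) 1 x) * (sandwich (-1) 1 y) * _ by simp [sandwich_apply]⟩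

theorem H_iso_neg_right : (H a b).Iso (H a (-b)) :=
  ⟨sandwich (-1) 1, fun (x y : ℍ[ℝ]) => show sandwich (-1) 1 (a * x * y * _) =
    _ * (sandwich (-1) 1 x) * (sandwich (-1) 1 y) * _ by simp [sandwich_apply]⟩

theorem starH_iso_neg_left : (starH a b).Iso (starH (-a) b) :=
  ⟨sandwich (-1) 1, fun (x y : ℍ[ℝ]) => show sandwich (-1) 1 (star x * a * y * _) =
    star (sandwich (-1) 1 x) * _ * (sandwich (-1) 1 y) * _ by simp [sandwich_apply]⟩

theorem starH_iso_neg_right : (starH a b).Iso (starH a (-b)) :=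
  ⟨sandwich (-1) 1, fun (x y : ℍ[ℝ]) => show sandwich (-1) 1 (star x * a * y * _) =
    star (sandwich (-1) 1 x) * _ * (sandwich (-1) 1 y) * _ by simp [sandwich_apply]⟩

theorem starHstar_iso_neg_left : (starHstar a b).Iso (starHstar (-a) b) :=
  ⟨sandwich (-1) 1, fun (x y : ℍ[ℝ]) => show sandwich (-1) 1 (a * star x * star y * _) =
    _ * star (sandwich (-1) 1 x) * star (sandwich (-1) 1 y) * _ by simp [sandwich_apply]⟩

theorem starHstar_iso_neg_right : (starHstar a b).Iso (starHstar a (-b)) :=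
  ⟨sandwich (-1) 1, fun (x y : ℍ[ℝ]) => show sandwich (-1) 1 (a * star x * star y * _) =
    _ * star (sandwich (-1) 1 x) * star (sandwich (-1) 1 y) * _ by simp [sandwich_apply]⟩

/-- Quaternion conjugation exchanges the two families with one bar, up to passing to the opposite
algebra. -/
theorem starH_op_iso : (starH a b).op.Iso (Hstar b⁻¹ a⁻¹) :=
  ⟨conjEquiv, fun (x y : ℍ[ℝ]) => show conjEquiv (star y * a * x * b) =
    _ * conjEquiv x * _ * star (conjEquiv y) by
      simp [conjEquiv_apply, mul_assoc, UnitQuaternion.star_coe]⟩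

end Conjugation

end PrincipalIsotope

namespace PrincipalIsotope
open AbsoluteValuedAlgebra

theorem eq_one_or_eq_neg_one_of_coe_eq {a : UnitQuaternion} {c : ℝ}
    (ha : (a : ℍ[ℝ]) = quat c 0 0 0) : a = 1 ∨ a = -1 := by
  have h := quat.sq_norm c 0 0 0
  rw [← ha, norm_eq_of_mem_sphere] at h
  rcases mul_self_eq_one_iff.1 (show c * c = 1 by linarith) with rfl | rfl
  · exact Or.inl (Subtype.ext (ha.trans (by ext <;> simp)))
  · exact Or.inr (Subtype.ext (ha.trans (by ext <;> simp)))

theorem eq_unitI_or_eq_neg_unitI_of_coe_eq {a : UnitQuaternion} {s : ℝ}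
    (ha : (a : ℍ[ℝ]) = quat 0 s 0 0) : a = unitI ∨ a = -unitI := by
  have h := quat.sq_norm 0 s 0 0
  rw [← ha, norm_eq_of_mem_sphere] at h
  rcases mul_self_eq_one_iff.1 (show s * s = 1 by linarith) with rfl | rfl
  · exact Or.inl (Subtype.ext (ha.trans coe_unitI.symm))
  · refine Or.inr (Subtype.ext (ha.trans ?_))
    change _ = -(unitI : ℍ[ℝ])
    rw [coe_unitI]
    ext <;> simp

variable (a b : UnitQuaternion)

theorem H_op_iso : (H a b).op.Iso (H b⁻¹ a⁻¹) :=
  ⟨conjEquiv, fun (x y : ℍ[ℝ]) => show conjEquiv (a * y * x * b) =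
    _ * conjEquiv x * conjEquiv y * _ by
      simp [conjEquiv_apply, mul_assoc, UnitQuaternion.star_coe]⟩

theorem starHstar_op_iso : (starHstar a b).op.Iso (starHstar b⁻¹ a⁻¹) :=
  ⟨conjEquiv, fun (x y : ℍ[ℝ]) => show conjEquiv (a * star y * star x * b) =
    _ * star (conjEquiv x) * star (conjEquiv y) * _ by
      simp [conjEquiv_apply, mul_assoc, UnitQuaternion.star_coe]⟩

variable {a b}

theorem H_satisfies_op {p q r : ℕ} (hp : p = 1 ∨ p = 2) (hq : q = 1 ∨ q = 2) (hr : r = 1 ∨ r = 2)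
    (h : (H a b).Satisfies p q r) : (H b⁻¹ a⁻¹).Satisfies r q p :=
  (H_op_iso a b).satisfies ((op_satisfies _ hr hq hp).2 h)

theorem starHstar_satisfies_op {p q r : ℕ} (hp : p = 1 ∨ p = 2) (hq : q = 1 ∨ q = 2)
    (hr : r = 1 ∨ r = 2)
    (h : (starHstar a b).Satisfies p q r) : (starHstar b⁻¹ a⁻¹).Satisfies r q p :=
  (starHstar_op_iso a b).satisfies ((op_satisfies _ hr hq hp).2 h)

/-! ### The identity in three squares -/

/-- Every quaternion is a square. -/
theorem exists_mul_self_eq (y : ℍ[ℝ]) : ∃ x : ℍ[ℝ], x * x = y := by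
  obtain ⟨p, c, s, -, h⟩ := exists_conj_complex y
  obtain ⟨z, hz⟩ := IsAlgClosed.exists_eq_mul_self (⟨c, s⟩ : ℂ)
  have hz' : quat z.re z.im 0 0 * quat z.re z.im 0 0 = quat c s 0 0 := by
    have h1 := congrArg Complex.re hz
    have h2 := congrArg Complex.im hz
    simp only [Complex.mul_re, Complex.mul_im] at h1 h2
    simp only [quat.mul, quat.inj, h1, h2]
    refine ⟨?_, ?_, ?_, ?_⟩ <;> ring
  refine ⟨(p : ℍ[ℝ])⁻¹ * quat z.re z.im 0 0 * p, ?_⟩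
  calc _ = (p : ℍ[ℝ])⁻¹ * (quat z.re z.im 0 0 * quat z.re z.im 0 0) * p := by simp [mul_assoc]
    _ = y := by rw [hz', mul_assoc, ← h]; simp

/-- Squaring is onto in `ℍ(a,b)`, so the identity in three squares holds for all elements. -/
theorem H_satisfies_111_of_222 (h : (H a b).Satisfies 2 2 2) : (H a b).Satisfies 1 1 1 := by
  rw [satisfies_iff] at *
  intro (y : ℍ[ℝ])
  obtain ⟨x, hx⟩ := exists_mul_self_eq ((a : ℍ[ℝ])⁻¹ * y * (b : ℍ[ℝ])⁻¹)
  have hy : (H a b).pow x 2 = y := by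
    change (a : ℍ[ℝ]) * x * x * b = y
    rw [mul_assoc (a : ℍ[ℝ]), hx]
    simp [mul_assoc]
  have := h x
  rwa [hy] at this

theorem starHstar_satisfies_111_of_222 (h : (starHstar a b).Satisfies 2 2 2) :
    (starHstar a b).Satisfies 1 1 1 := by
  rw [satisfies_iff] at *
  intro (y : ℍ[ℝ])
  obtain ⟨x, hx⟩ := exists_mul_self_eq ((a : ℍ[ℝ])⁻¹ * y * (b : ℍ[ℝ])⁻¹)
  have hy : (starHstar a b).pow (star x : ℍ[ℝ]) 2 = y := by
    change (a : ℍ[ℝ]) * star (star x) * star (star x) * b = y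
    rw [star_star, mul_assoc (a : ℍ[ℝ]), hx]
    simp [mul_assoc]
  have := h (star x : ℍ[ℝ])
  rwa [hy] at this

/-! ### Isotopes satisfying an identity -/

section Solve
variable {a b : UnitQuaternion} {c s p q r : ℝ}

theorem NormalPosition.left_eq (N : NormalPosition a b c s p q r) (hs : s = 0) :
    a = 1 ∨ a = -1 := by
  subst hs
  exact eq_one_or_eq_neg_one_of_coe_eq N.left

theorem NormalPosition.right_eq (N : NormalPosition a b c s p q r) (hq : q = 0) (hr : r = 0) :
    b = 1 ∨ b = -1 := by
  subst hq hr
  exact eq_one_or_eq_neg_one_of_coe_eq N.right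

theorem H_iso_of_signs {a' b' : UnitQuaternion} (ha : a = a' ∨ a = -a') (hb : b = b' ∨ b = -b') :
    (H a b).Iso (H a' b') := by
  have h1 : (H a b).Iso (H a' b) := by
    rcases ha with rfl | rfl
    · exact Iso.refl _
    · exact (H_iso_neg_left a' b).symm
  have h2 : (H a' b).Iso (H a' b') := by
    rcases hb with rfl | rfl
    · exact Iso.refl _
    · exact (H_iso_neg_right a' b').symm
  exact h1.trans h2

theorem starH_iso_of_signs {a' b' : UnitQuaternion} (ha : a = a' ∨ a = -a')
    (hb : b = b' ∨ b = -b') : (starH a b).Iso (starH a' b') := by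
  have h1 : (starH a b).Iso (starH a' b) := by
    rcases ha with rfl | rfl
    · exact Iso.refl _
    · exact (starH_iso_neg_left a' b).symm
  have h2 : (starH a' b).Iso (starH a' b') := by
    rcases hb with rfl | rfl
    · exact Iso.refl _
    · exact (starH_iso_neg_right a' b').symm
  exact h1.trans h2

theorem starHstar_iso_of_signs {a' b' : UnitQuaternion} (ha : a = a' ∨ a = -a')
    (hb : b = b' ∨ b = -b') : (starHstar a b).Iso (starHstar a' b') := by
  have h1 : (starHstar a b).Iso (starHstar a' b) := by
    rcases ha with rfl | rfl
    · exact Iso.refl _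
    · exact (starHstar_iso_neg_left a' b).symm
  have h2 : (starHstar a' b).Iso (starHstar a' b') := by
    rcases hb with rfl | rfl
    · exact Iso.refl _
    · exact (starHstar_iso_neg_right a' b').symm
  exact h1.trans h2

/-- An identity that forces trivial parameters in normal position characterises `ℍ` among the
isotopes `ℍ(a,b)`. -/
theorem H_iso_one_of_normal {k l m : ℕ} (key : ∀ {a b : UnitQuaternion} {c s p q r : ℝ},
      NormalPosition a b c s p q r → (H a b).Satisfies k l m → s = 0 ∧ q = 0 ∧ r = 0)
    (h : (H a b).Satisfies k l m) : (H a b).Iso (H 1 1) := by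
  obtain ⟨g, c, s, p, q, r, N⟩ := exists_normalPosition a b
  have e := H_iso_conj a b g
  obtain ⟨hs, hq, hr⟩ := key N (e.satisfies h)
  exact e.trans (H_iso_of_signs (N.left_eq hs) (N.right_eq hq hr))

theorem starHstar_iso_one_of_normal {k l m : ℕ} (key : ∀ {a b : UnitQuaternion} {c s p q r : ℝ},
      NormalPosition a b c s p q r → (starHstar a b).Satisfies k l m → s = 0 ∧ q = 0 ∧ r = 0)
    (h : (starHstar a b).Satisfies k l m) : (starHstar a b).Iso (starHstar 1 1) := by
  obtain ⟨g, c, s, p, q, r, N⟩ := exists_normalPosition a b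
  have e := starHstar_iso_conj a b g
  obtain ⟨hs, hq, hr⟩ := key N (e.satisfies h)
  exact e.trans (starHstar_iso_of_signs (N.left_eq hs) (N.right_eq hq hr))

theorem H_one_op_iso : (H 1 1).op.Iso (H 1 1) := by
  simpa only [inv_one] using H_op_iso 1 1

/-- Each of the eight identities singles out `ℍ` among the isotopes `ℍ(a,b)`. -/
theorem H_iso_one {k l m : ℕ} (hk : k = 1 ∨ k = 2) (hl : l = 1 ∨ l = 2) (hm : m = 1 ∨ m = 2)
    (h : (H a b).Satisfies k l m) : (H a b).Iso (H 1 1) := by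
  have rev : (H b⁻¹ a⁻¹).Iso (H 1 1) → (H a b).Iso (H 1 1) := fun h =>
    op_iso_op_iff.1 (((H_op_iso a b).trans h).trans H_one_op_iso.symm)
  have h' := H_satisfies_op hk hl hm h
  rcases hk with rfl | rfl <;> rcases hl with rfl | rfl <;> rcases hm with rfl | rfl
  · exact H_iso_one_of_normal H_satisfies_111_of_normal h
  · exact H_iso_one_of_normal H_satisfies_112_of_normal h
  · exact H_iso_one_of_normal H_satisfies_121_of_normal h
  · exact H_iso_one_of_normal H_satisfies_122_of_normal h
  · exact rev (H_iso_one_of_normal H_satisfies_112_of_normal h')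
  · exact H_iso_one_of_normal H_satisfies_212_of_normal h
  · exact rev (H_iso_one_of_normal H_satisfies_122_of_normal h')
  · exact H_iso_one_of_normal H_satisfies_111_of_normal (H_satisfies_111_of_222 h)

/-- The exponents must read the same backwards: the other four identities fail in every doubly
starred isotope. -/
theorem starHstar_iso_one_of_palindrome {k l : ℕ} (hk : k = 1 ∨ k = 2) (hl : l = 1 ∨ l = 2)
    (h : (starHstar a b).Satisfies k l k) : (starHstar a b).Iso (starHstar 1 1) := by
  rcases hk with rfl | rfl <;> rcases hl with rfl | rfl
  · exact starHstar_iso_one_of_normal starHstar_satisfies_111_of_normal h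
  · exact starHstar_iso_one_of_normal starHstar_satisfies_121_of_normal h
  · exact starHstar_iso_one_of_normal starHstar_satisfies_212_of_normal h
  · exact starHstar_iso_one_of_normal starHstar_satisfies_111_of_normal
      (starHstar_satisfies_111_of_222 h)

theorem not_starHstar_satisfies_112 : ¬ (starHstar a b).Satisfies 1 1 2 := fun h => by
  obtain ⟨g, c, s, p, q, r, N⟩ := exists_normalPosition a b
  exact not_starHstar_satisfies_112_of_normal N ((starHstar_iso_conj a b g).satisfies h)

theorem not_starHstar_satisfies_122 : ¬ (starHstar a b).Satisfies 1 2 2 := fun h => by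
  obtain ⟨g, c, s, p, q, r, N⟩ := exists_normalPosition a b
  exact not_starHstar_satisfies_122_of_normal N ((starHstar_iso_conj a b g).satisfies h)

theorem not_starHstar_satisfies_211 : ¬ (starHstar a b).Satisfies 2 1 1 := fun h =>
  not_starHstar_satisfies_112
    (starHstar_satisfies_op (.inr rfl) (.inl rfl) (.inl rfl) h)

theorem not_starHstar_satisfies_221 : ¬ (starHstar a b).Satisfies 2 2 1 := fun h =>
  not_starHstar_satisfies_122
    (starHstar_satisfies_op (.inr rfl) (.inr rfl) (.inl rfl) h)

theorem not_starH_satisfies_111 : ¬ (starH a b).Satisfies 1 1 1 := fun h => by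
  obtain ⟨g, c, s, p, q, r, N⟩ := exists_normalPosition a b
  exact not_starH_satisfies_111_of_normal N ((starH_iso_conj a b g).satisfies h)

theorem not_starH_satisfies_112 : ¬ (starH a b).Satisfies 1 1 2 := fun h => by
  obtain ⟨g, c, s, p, q, r, N⟩ := exists_normalPosition a b
  exact not_starH_satisfies_112_of_normal N ((starH_iso_conj a b g).satisfies h)

theorem not_starH_satisfies_121 : ¬ (starH a b).Satisfies 1 2 1 := fun h => by
  obtain ⟨g, c, s, p, q, r, N⟩ := exists_normalPosition a b
  exact not_starH_satisfies_121_of_normal N ((starH_iso_conj a b g).satisfies h)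

theorem not_starH_satisfies_122 : ¬ (starH a b).Satisfies 1 2 2 := fun h => by
  obtain ⟨g, c, s, p, q, r, N⟩ := exists_normalPosition a b
  exact not_starH_satisfies_122_of_normal N ((starH_iso_conj a b g).satisfies h)

theorem starH_iso_one_of_211 (h : (starH a b).Satisfies 2 1 1) :
    (starH a b).Iso (starH 1 1) := by
  obtain ⟨g, c, s, p, q, r, N⟩ := exists_normalPosition a b
  have e := starH_iso_conj a b g
  obtain ⟨hs, hq, hr⟩ := starH_satisfies_211_of_normal N (e.satisfies h)
  exact e.trans (starH_iso_of_signs (N.left_eq hs) (N.right_eq hq hr))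

theorem NormalPosition.left_eq_unitI (N : NormalPosition a b c s p q r) (hc : c = 0) :
    a = unitI ∨ a = -unitI := by
  subst hc
  exact eq_unitI_or_eq_neg_unitI_of_coe_eq N.left

theorem NormalPosition.right_eq_unitI (N : NormalPosition a b c s p q r) (hp : p = 0)
    (hr : r = 0) : b = unitI ∨ b = -unitI := by
  subst hp hr
  exact eq_unitI_or_eq_neg_unitI_of_coe_eq N.right

theorem starH_iso_of_221 (h : (starH a b).Satisfies 2 2 1) :
    (starH a b).Iso (starH 1 1) ∨ (starH a b).Iso (starH unitI 1) := by
  obtain ⟨g, c, s, p, q, r, N⟩ := exists_normalPosition a b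
  have e := starH_iso_conj a b g
  obtain ⟨hq, hr, hcs⟩ := starH_satisfies_221_of_normal N (e.satisfies h)
  rcases mul_eq_zero.1 hcs with hc | hs
  · exact Or.inr (e.trans (starH_iso_of_signs (N.left_eq_unitI hc) (N.right_eq hq hr)))
  · exact Or.inl (e.trans (starH_iso_of_signs (N.left_eq hs) (N.right_eq hq hr)))

theorem expI_zero : expI 0 = 1 :=
  Subtype.ext ((coe_expI 0).trans (by ext <;> simp))

/-- The isotopes `*ℍ(1,b)` are exhausted by the family `*ℍ(1,e^{iα})`, `0 ≤ α < π`. -/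
theorem starH_one_iso_expI (b : UnitQuaternion) :
    ∃ α ∈ Set.Ico 0 Real.pi, (starH 1 b).Iso (starH 1 (expI α)) := by
  obtain ⟨g, c, s, hs, hg⟩ := exists_conj_complex b
  have hb : ((g * b * g⁻¹ : UnitQuaternion) : ℍ[ℝ]) = quat c s 0 0 := by
    rw [Metric.unitSphere.coe_mul, Metric.unitSphere.coe_mul, hg]
    simp [mul_assoc]
  have e : (starH 1 b).Iso (starH 1 (g * b * g⁻¹)) := by simpa using starH_iso_conj 1 b g
  have hcs := quat.sq_norm c s 0 0
  rw [← hb, norm_eq_of_mem_sphere] at hcs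
  rcases (Real.arccos_le_pi c).lt_or_eq with hlt | heq
  · refine ⟨Real.arccos c, ⟨Real.arccos_nonneg c, hlt⟩, e.trans ?_⟩
    have : g * b * g⁻¹ = expI (Real.arccos c) := Subtype.ext <| by
      rw [hb, coe_expI, Real.cos_arccos (by nlinarith) (by nlinarith), Real.sin_arccos,
        show 1 - c ^ 2 = s ^ 2 by linarith, Real.sqrt_sq hs]
    rw [this]
    exact Iso.refl _
  · -- the excluded value `α = π` gives `b = -1`, which has the same isotope as `b = 1`
    have hc : c ≤ -1 := Real.arccos_eq_pi.1 heq
    obtain rfl : s = 0 := by nlinarith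
    refine ⟨0, ⟨le_rfl, Real.pi_pos⟩, e.trans ?_⟩
    rw [expI_zero]
    exact starH_iso_of_signs (.inl rfl) (eq_one_or_eq_neg_one_of_coe_eq hb)

theorem starH_iso_of_212 (h : (starH a b).Satisfies 2 1 2) :
    ∃ α ∈ Set.Ico 0 Real.pi, (starH a b).Iso (starH 1 (expI α)) := by
  obtain ⟨g, c, s, p, q, r, N⟩ := exists_normalPosition a b
  have e := starH_iso_conj a b g
  have hs := starH_satisfies_212_of_normal N (e.satisfies h)
  obtain ⟨α, hα, e'⟩ := starH_one_iso_expI (g * b * g⁻¹)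
  exact ⟨α, hα, (e.trans (starH_iso_of_signs (N.left_eq hs) (.inl rfl))).trans e'⟩

theorem starH_iso_of_222 (h : (starH a b).Satisfies 2 2 2) :
    (starH a b).Iso (starH unitI 1) ∨ (starH a b).Iso (starH unitI unitI) ∨
    ∃ α ∈ Set.Ico 0 Real.pi, (starH a b).Iso (starH 1 (expI α)) := by
  obtain ⟨g, c, s, p, q, r, N⟩ := exists_normalPosition a b
  have e := starH_iso_conj a b g
  rcases starH_satisfies_222_of_normal N (e.satisfies h) with hs | ⟨hc, hr, hpq⟩
  · obtain ⟨α, hα, e'⟩ := starH_one_iso_expI (g * b * g⁻¹)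
    exact .inr (.inr ⟨α, hα, (e.trans (starH_iso_of_signs (N.left_eq hs) (.inl rfl))).trans e'⟩)
  · rcases mul_eq_zero.1 hpq with hp | hq
    · exact .inr (.inl (e.trans (starH_iso_of_signs (N.left_eq_unitI hc)
        (N.right_eq_unitI hp hr))))
    · exact .inl (e.trans (starH_iso_of_signs (N.left_eq_unitI hc) (N.right_eq hq hr)))

end Solve

/-! ### The listed algebras satisfy the identities -/

theorem H_one_satisfies (k l m : ℕ) : (H 1 1).Satisfies k l m := by
  rw [satisfies_iff]
  intro (x : ℍ[ℝ])
  have : ∀ x y z : ℍ[ℝ], (1 * (1 * x * y * 1) * z * 1 : ℍ[ℝ]) = 1 * x * (1 * y * z * 1) * 1 := by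
    simp [mul_assoc]
  exact this _ _ _

/-- In the doubly starred isotope with trivial parameters all expressions in `x` are words in the
commuting quaternions `x` and `x̄`. -/
theorem starHstar_one_satisfies {k l : ℕ} (hk : k = 1 ∨ k = 2) (hl : l = 1 ∨ l = 2) :
    (starHstar 1 1).Satisfies k l k := by
  rw [satisfies_iff]
  intro (x : ℍ[ℝ])
  have h1 : star x * x = x * star x := by
    rw [Quaternion.star_mul_self, Quaternion.self_mul_star]
  have h2 (z : ℍ[ℝ]) : star x * (x * z) = x * (star x * z) := by
    rw [← mul_assoc, h1, mul_assoc]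
  have hpow {n : ℕ} (hn : n = 1 ∨ n = 2) : (starHstar 1 1).pow x n = x ∨
      (starHstar 1 1).pow x n = star x * star x := by
    rcases hn with rfl | rfl
    · exact .inl rfl
    · right
      change (1 : ℍ[ℝ]) * star x * star x * 1 = _
      rw [one_mul, mul_one]
  have key (y z : ℍ[ℝ]) (hy : y = x ∨ y = star x * star x) (hz : z = x ∨ z = star x * star x) :
      1 * star (1 * star y * star z * 1) * star y * 1 =
        1 * star y * star (1 * star z * star y * 1) * 1 := by
    rcases hy with rfl | rfl <;> rcases hz with rfl | rfl <;>
      simp only [one_mul, mul_one, star_mul, star_star, mul_assoc, h1, h2]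
  exact key _ _ (hpow hk) (hpow hl)

theorem starH_one_pow_two (b : UnitQuaternion) (x : ℍ[ℝ]) :
    (starH 1 b).pow x 2 = (Quaternion.normSq x) • (b : ℍ[ℝ]) := by
  change star x * (1 : ℍ[ℝ]) * x * b = _
  rw [mul_one, Quaternion.star_mul_self, Quaternion.coe_mul_eq_smul]

/-- Every square in `*ℍ(1,b)` is a multiple of the idempotent `b`. -/
theorem starH_one_satisfies_212 (b : UnitQuaternion) : (starH 1 b).Satisfies 2 1 2 := by
  rw [satisfies_iff]
  intro (x : ℍ[ℝ])
  rw [starH_one_pow_two]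
  change star (star ((Quaternion.normSq x) • (b : ℍ[ℝ])) * (1 : ℍ[ℝ]) * x * b) * (1 : ℍ[ℝ]) *
      ((Quaternion.normSq x) • (b : ℍ[ℝ])) * b =
    star ((Quaternion.normSq x) • (b : ℍ[ℝ])) * (1 : ℍ[ℝ]) *
      (star x * (1 : ℍ[ℝ]) * ((Quaternion.normSq x) • (b : ℍ[ℝ])) * b) * b
  simp [mul_assoc, UnitQuaternion.star_coe, Quaternion.star_smul]

theorem starH_one_satisfies_222 (b : UnitQuaternion) : (starH 1 b).Satisfies 2 2 2 := by
  rw [satisfies_iff]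
  intro (x : ℍ[ℝ])
  rw [starH_one_pow_two]
  change star (star ((Quaternion.normSq x) • (b : ℍ[ℝ])) * (1 : ℍ[ℝ]) *
      ((Quaternion.normSq x) • (b : ℍ[ℝ])) * b) * (1 : ℍ[ℝ]) *
      ((Quaternion.normSq x) • (b : ℍ[ℝ])) * b =
    star ((Quaternion.normSq x) • (b : ℍ[ℝ])) * (1 : ℍ[ℝ]) *
      (star ((Quaternion.normSq x) • (b : ℍ[ℝ])) * (1 : ℍ[ℝ]) *
        ((Quaternion.normSq x) • (b : ℍ[ℝ])) * b) * b
  simp [UnitQuaternion.star_coe, Quaternion.star_smul]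

theorem starH_one_one_satisfies_211 : (starH 1 1).Satisfies 2 1 1 := by
  rw [satisfies_iff]
  intro (x : ℍ[ℝ])
  rw [starH_one_pow_two]
  change star (star ((Quaternion.normSq x) • (1 : ℍ[ℝ])) * (1 : ℍ[ℝ]) * x * 1) * (1 : ℍ[ℝ]) *
      x * 1 =
    star ((Quaternion.normSq x) • (1 : ℍ[ℝ])) * (1 : ℍ[ℝ]) *
      (star x * (1 : ℍ[ℝ]) * x * 1) * 1
  simp [Quaternion.star_smul]

theorem starH_one_one_satisfies_221 : (starH 1 1).Satisfies 2 2 1 := by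
  rw [satisfies_iff]
  intro (x : ℍ[ℝ])
  rw [starH_one_pow_two]
  change star (star ((Quaternion.normSq x) • (1 : ℍ[ℝ])) * (1 : ℍ[ℝ]) *
      ((Quaternion.normSq x) • (1 : ℍ[ℝ])) * 1) * (1 : ℍ[ℝ]) * x * 1 =
    star ((Quaternion.normSq x) • (1 : ℍ[ℝ])) * (1 : ℍ[ℝ]) *
      (star ((Quaternion.normSq x) • (1 : ℍ[ℝ])) * (1 : ℍ[ℝ]) * x * 1) * 1
  simp [Quaternion.star_smul]

theorem star_unitI : star (unitI : ℍ[ℝ]) = -unitI := by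
  rw [coe_unitI]; ext <;> simp

theorem unitI_mul_self : (unitI : ℍ[ℝ]) * unitI = -1 := by
  rw [coe_unitI]; ext <;> simp

/-- The element `x̄ i x` is purely imaginary. -/
theorem star_star_mul_unitI_mul (x : ℍ[ℝ]) :
    star (star x * unitI * x) = -(star x * unitI * x) := by
  simp [star_unitI, mul_assoc]

theorem starH_unitI_one_mul_pow_two (x z : ℍ[ℝ]) :
    (starH unitI 1).mul ((starH unitI 1).mul ((starH unitI 1).pow x 2) ((starH unitI 1).pow x 2)) z
      = (starH unitI 1).mul ((starH unitI 1).pow x 2)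
        ((starH unitI 1).mul ((starH unitI 1).pow x 2) z) := by
  change star (star (star x * unitI * x * 1) * (unitI : ℍ[ℝ]) * (star x * unitI * x * 1) * 1) *
      unitI * z * 1 = star (star x * unitI * x * 1) * (unitI : ℍ[ℝ]) *
        (star (star x * unitI * x * 1) * (unitI : ℍ[ℝ]) * z * 1) * 1
  have h := star_star_mul_unitI_mul x
  generalize star x * unitI * x = n at h
  simp [h, star_unitI, mul_assoc]

theorem starH_unitI_one_satisfies_221 : (starH unitI 1).Satisfies 2 2 1 := by
  rw [satisfies_iff]
  exact fun x => starH_unitI_one_mul_pow_two x x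

theorem starH_unitI_one_satisfies_222 : (starH unitI 1).Satisfies 2 2 2 := by
  rw [satisfies_iff]
  exact fun x => starH_unitI_one_mul_pow_two x _

theorem starH_unitI_unitI_satisfies_222 : (starH unitI unitI).Satisfies 2 2 2 := by
  rw [satisfies_iff]
  intro (x : ℍ[ℝ])
  change star (star (star x * unitI * x * unitI) * (unitI : ℍ[ℝ]) *
        (star x * unitI * x * unitI) * unitI) * unitI * (star x * unitI * x * unitI) * unitI =
    star (star x * unitI * x * unitI) * (unitI : ℍ[ℝ]) *
        (star (star x * unitI * x * unitI) * (unitI : ℍ[ℝ]) *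
          (star x * unitI * x * unitI) * unitI) * unitI
  have h := star_star_mul_unitI_mul x
  generalize star x * unitI * x = n at h
  have h1 : n * n = ((-Quaternion.normSq n : ℝ) : ℍ[ℝ]) := by
    rw [Quaternion.coe_neg, ← Quaternion.star_mul_self, h, neg_mul, neg_neg]
  have h2 (z : ℍ[ℝ]) : n * (n * z) = (-Quaternion.normSq n) • z := by
    rw [← mul_assoc, h1, Quaternion.coe_mul_eq_smul]
  have h3 (z : ℍ[ℝ]) : (unitI : ℍ[ℝ]) * (unitI * z) = -z := by
    rw [← mul_assoc, unitI_mul_self, neg_one_mul]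
  simp [h, h2, h3, star_unitI, unitI_mul_self, mul_assoc]

end PrincipalIsotope

/-! ### The norm is Euclidean -/

section EuclideanNorm
open MeasureTheory

/-- A linear isometry of a finite-dimensional normed space preserves every additive Haar measure,
because it maps the unit ball onto itself. -/
theorem LinearIsometryEquiv.measurePreserving_addHaar {E : Type*} [NormedAddCommGroup E]
    [NormedSpace ℝ E] [FiniteDimensional ℝ E] [MeasurableSpace E] [BorelSpace E]
    (μ : Measure E) [μ.IsAddHaarMeasure] (T : E ≃ₗᵢ[ℝ] E) : MeasurePreserving T μ μ := by
  refine ⟨T.continuous.measurable, ?_⟩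
  have hdet : LinearMap.det (T.toLinearEquiv : E →ₗ[ℝ] E) ≠ 0 :=
    T.toLinearEquiv.isUnit_det'.ne_zero
  have h := Measure.map_linearMap_addHaar_eq_smul_addHaar μ hdet
  have hT : ⇑(T.toLinearEquiv : E →ₗ[ℝ] E) = T := rfl
  rw [hT] at h
  set c := ENNReal.ofReal |(LinearMap.det (T.toLinearEquiv : E →ₗ[ℝ] E))⁻¹|
  have hb := congrArg (fun ν : Measure E => ν (Metric.ball 0 1)) h
  simp only [Measure.smul_apply, smul_eq_mul] at hb
  rw [Measure.map_apply T.continuous.measurable measurableSet_ball, T.preimage_ball, map_zero]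
    at hb
  have hc : c = 1 := by
    have h0 : μ (Metric.ball 0 1) ≠ 0 := (Metric.measure_ball_pos μ 0 one_pos).ne'
    have h1 : μ (Metric.ball 0 1) ≠ ⊤ := measure_ball_lt_top.ne
    have : c * μ (Metric.ball 0 1) = 1 * μ (Metric.ball 0 1) := by rw [← hb, one_mul]
    exact (ENNReal.mul_left_inj h0 h1).1 this
  rw [h, hc, one_smul]

/-- The norm of a finite-dimensional absolute-valued algebra is Euclidean. For a nonzero linear
form `φ`, the quadratic form `x ↦ ∫ φ(xy)² dy` over the unit ball is a multiple of `‖x‖²`, since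
left multiplication by a unit vector preserves the ball and the measure. -/
theorem parallelogram_of_norm_mul {E : Type*} [NormedAddCommGroup E] [NormedSpace ℝ E]
    [FiniteDimensional ℝ E] [Nontrivial E] (m : E →ₗ[ℝ] E →ₗ[ℝ] E)
    (hm : ∀ x y, ‖m x y‖ = ‖x‖ * ‖y‖) (x y : E) :
    ‖x + y‖ * ‖x + y‖ + ‖x - y‖ * ‖x - y‖ = 2 * (‖x‖ * ‖x‖ + ‖y‖ * ‖y‖) := by
  let _ : MeasurableSpace E := borel E
  have : BorelSpace E := ⟨rfl⟩
  have := FiniteDimensional.proper ℝ E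
  let μ : Measure E := Measure.addHaar
  obtain ⟨v, hv⟩ := exists_ne (0 : E)
  obtain ⟨φ, -, hφ⟩ := exists_dual_vector ℝ v (norm_ne_zero_iff.2 hv)
  let q : E → ℝ := fun x => ∫ y in Metric.closedBall (0 : E) 1, (φ (m x y)) ^ 2 ∂μ
  let C : ℝ := ∫ y in Metric.closedBall (0 : E) 1, (φ y) ^ 2 ∂μ
  have hint : ∀ x, IntegrableOn (fun y => (φ (m x y)) ^ 2) (Metric.closedBall (0 : E) 1) μ :=
    fun x => ((φ.continuous.comp (m x).continuous_of_finiteDimensional).pow 2).continuousOn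
      |>.integrableOn_compact (isCompact_closedBall _ _)
  have hintC : IntegrableOn (fun y => (φ y) ^ 2) (Metric.closedBall (0 : E) 1) μ :=
    (φ.continuous.pow 2).continuousOn.integrableOn_compact (isCompact_closedBall _ _)
  have hunit : ∀ x, ‖x‖ = 1 → q x = C := by
    intro x hx
    let T₀ : E →ₗᵢ[ℝ] E := ⟨m x, fun y => by rw [hm, hx, one_mul]⟩
    let T : E ≃ₗᵢ[ℝ] E := T₀.toLinearIsometryEquiv rfl
    have h := (T.measurePreserving_addHaar μ).setIntegral_preimage_emb
      T.toHomeomorph.measurableEmbedding (fun y => (φ y) ^ 2) (Metric.closedBall 0 1)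
    rw [T.preimage_closedBall, map_zero] at h
    exact h
  have hq : ∀ x, q x = C * (‖x‖ * ‖x‖) := by
    intro x
    rcases eq_or_ne x 0 with rfl | hx
    · simp [q]
    · have h1 := hunit (‖x‖⁻¹ • x) (by simp [norm_smul, hx])
      have h2 : q (‖x‖⁻¹ • x) = (‖x‖⁻¹) ^ 2 * q x := by
        simp only [q, map_smul, LinearMap.smul_apply, smul_eq_mul, mul_pow]
        exact integral_const_mul _ _
      rw [h2] at h1
      have : ‖x‖ ≠ 0 := norm_ne_zero_iff.2 hx
      rw [← h1]
      field_simp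
  have hC : 0 < C := by
    refine (setIntegral_pos_iff_support_of_nonneg_ae (Filter.Eventually.of_forall fun y =>
      sq_nonneg (φ y)) hintC).2 ?_
    have hopen : IsOpen ({y | φ y ≠ 0} ∩ Metric.ball (0 : E) 1) :=
      (isOpen_ne_fun φ.continuous continuous_const).inter Metric.isOpen_ball
    refine (hopen.measure_pos μ ⟨((2 * ‖v‖)⁻¹) • v, ?_, ?_⟩).trans_le (measure_mono ?_)
    · simp [hφ, hv]
    · have : ‖v‖ ≠ 0 := norm_ne_zero_iff.2 hv
      simp only [mem_ball_zero_iff, norm_smul, norm_inv, norm_mul, norm_norm, Real.norm_ofNat]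
      field_simp
      norm_num
    · exact fun y hy => ⟨by simpa using hy.1, Metric.ball_subset_closedBall hy.2⟩
  have hpar : q (x + y) + q (x - y) = 2 * (q x + q y) := by
    simp only [q]
    rw [← integral_add (hint _) (hint _), ← integral_add (hint _) (hint _), ← integral_const_mul]
    congr 1
    ext z
    simp only [map_add, map_sub, LinearMap.add_apply, LinearMap.sub_apply]
    ring
  rw [hq, hq, hq, hq] at hpar
  exact mul_left_cancel₀ hC.ne' (by linarith)

end EuclideanNorm

/-! ### Unital composition algebras of dimension four -/

section Hurwitz
open scoped InnerProductSpace

/-- A four-dimensional unital real algebra with a multiplicative Euclidean norm is isometrically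
isomorphic to the quaternions. -/
theorem exists_quaternion_isometry {E : Type*} [NormedAddCommGroup E] [InnerProductSpace ℝ E]
    (m : E →ₗ[ℝ] E →ₗ[ℝ] E) (hm : ∀ x y, ‖m x y‖ = ‖x‖ * ‖y‖) (e : E)
    (hl : ∀ x, m e x = x) (hr : ∀ x, m x e = x) (h4 : Module.finrank ℝ E = 4) :
    ∃ f : ℍ[ℝ] ≃ₗᵢ[ℝ] E, ∀ x y, f (x * y) = m (f x) (f y) := by
  have : FiniteDimensional ℝ E := .of_finrank_pos (by omega)
  have : Nontrivial E := Module.nontrivial_of_finrank_pos (R := ℝ) (by omega)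
  have he : ‖e‖ = 1 := by
    obtain ⟨v, hv⟩ := exists_ne (0 : E)
    have h := hm e v
    rw [hl] at h
    exact (mul_eq_right₀ (norm_ne_zero_iff.2 hv)).1 h.symm
  have hsq : ∀ x y, ⟪m x y, m x y⟫_ℝ = ⟪x, x⟫_ℝ * ⟪y, y⟫_ℝ := fun x y => by
    rw [real_inner_self_eq_norm_sq, real_inner_self_eq_norm_sq, real_inner_self_eq_norm_sq, hm,
      mul_pow]
  -- polarisations of the composition law
  have hleft : ∀ x y z, ⟪m x y, m x z⟫_ℝ = ⟪x, x⟫_ℝ * ⟪y, z⟫_ℝ := fun x y z => by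
    have h := hsq x (y + z)
    simp only [map_add, inner_add_left, inner_add_right, hsq] at h
    rw [real_inner_comm (m x y) (m x z), real_inner_comm y z] at h
    linarith
  have hright : ∀ x y z, ⟪m y x, m z x⟫_ℝ = ⟪x, x⟫_ℝ * ⟪y, z⟫_ℝ := fun x y z => by
    have h := hsq (y + z) x
    simp only [map_add, LinearMap.add_apply, inner_add_left, inner_add_right, hsq] at h
    rw [real_inner_comm (m y x) (m z x), real_inner_comm y z] at h
    linarith
  have hfour : ∀ x w y z, ⟪m x y, m w z⟫_ℝ + ⟪m w y, m x z⟫_ℝ = 2 * ⟪x, w⟫_ℝ * ⟪y, z⟫_ℝ :=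
    fun x w y z => by
      have h := hleft (x + w) y z
      simp only [map_add, LinearMap.add_apply, inner_add_left, inner_add_right, hleft] at h
      rw [real_inner_comm x w] at h
      linarith
  -- multiplication by an imaginary element is skew-adjoint
  have hskewl : ∀ u y z, ⟪u, e⟫_ℝ = 0 → ⟪m u y, z⟫_ℝ = -⟪y, m u z⟫_ℝ := fun u y z hu => by
    have h := hfour u e y z
    rw [hu, hl, hl] at h
    linarith
  have hskewr : ∀ u y z, ⟪u, e⟫_ℝ = 0 → ⟪m y u, z⟫_ℝ = -⟪y, m z u⟫_ℝ := fun u y z hu => by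
    have h := hfour y z u e
    rw [hu, hr, hr] at h
    have h' := real_inner_comm (m z u) y
    linarith
  have hll : ∀ u x, ⟪u, e⟫_ℝ = 0 → m u (m u x) = -(⟪u, u⟫_ℝ • x) := fun u x hu =>
    ext_inner_right ℝ fun z => by
      rw [hskewl u _ _ hu, hleft, inner_neg_left, real_inner_smul_left]
  have hrr : ∀ u x, ⟪u, e⟫_ℝ = 0 → m (m x u) u = -(⟪u, u⟫_ℝ • x) := fun u x hu =>
    ext_inner_right ℝ fun z => by
      rw [hskewr u _ _ hu, hright, inner_neg_left, real_inner_smul_left]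
  have hsquare : ∀ u, ⟪u, e⟫_ℝ = 0 → m u u = -(⟪u, u⟫_ℝ • e) := fun u hu => by
    rw [← hll u e hu, hr]
  have hanti : ∀ u v, ⟪u, e⟫_ℝ = 0 → ⟪v, e⟫_ℝ = 0 → ⟪u, v⟫_ℝ = 0 → m v u = -m u v :=
    fun u v hu hv huv => by
      have h := hsquare (u + v) (by rw [inner_add_left, hu, hv, add_zero])
      simp only [map_add, LinearMap.add_apply, inner_add_left, inner_add_right, huv,
        real_inner_comm u v, hsquare u hu, hsquare v hv] at h
      rw [eq_neg_iff_add_eq_zero]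
      simp only [add_smul, zero_add, add_zero, neg_add_rev] at h
      have h' : m v u + m u v = (-(⟪u, u⟫_ℝ • e) + m v u + (m u v + -(⟪v, v⟫_ℝ • e))) +
        (⟪u, u⟫_ℝ • e + ⟪v, v⟫_ℝ • e) := by abel
      rw [h', h]
      abel
  -- an orthonormal pair `i, j` of imaginary elements
  obtain ⟨i, j, hi, hj, hie, hje, hij⟩ : ∃ i j : E, ⟪i, i⟫_ℝ = 1 ∧ ⟪j, j⟫_ℝ = 1 ∧ ⟪i, e⟫_ℝ = 0 ∧
      ⟪j, e⟫_ℝ = 0 ∧ ⟪i, j⟫_ℝ = 0 := by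
    have he0 : e ≠ 0 := norm_ne_zero_iff.1 (by rw [he]; norm_num)
    have : Fact (Module.finrank ℝ E = 3 + 1) := ⟨h4⟩
    have h3 : Module.finrank ℝ (ℝ ∙ e)ᗮ = 3 := Submodule.finrank_orthogonal_span_singleton he0
    let b := (stdOrthonormalBasis ℝ (ℝ ∙ e)ᗮ).reindex (finCongr h3)
    have horth : ∀ x : (ℝ ∙ e)ᗮ, ⟪(x : E), e⟫_ℝ = 0 := fun x =>
      (Submodule.mem_orthogonal_singleton_iff_inner_left.1 x.2)
    have hb := orthonormal_iff_ite.1 b.orthonormal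
    exact ⟨b 0, b 1, (hb 0 0).trans (if_pos rfl), (hb 1 1).trans (if_pos rfl), horth _, horth _,
      (hb 0 1).trans (if_neg (by decide))⟩
  obtain ⟨k, hk⟩ : ∃ k, k = m i j := ⟨_, rfl⟩
  have hee : ⟪e, e⟫_ℝ = 1 := by rw [real_inner_self_eq_norm_sq, he, one_pow]
  have hkk : ⟪k, k⟫_ℝ = 1 := by rw [hk, hsq, hi, hj, one_mul]
  have hke : ⟪k, e⟫_ℝ = 0 := by
    rw [hk, hskewl i j e hie, hr, real_inner_comm, hij, neg_zero]
  have hik : ⟪i, k⟫_ℝ = 0 := by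
    have h := hleft i e j
    rw [hr, real_inner_comm j e, hje, mul_zero] at h
    rw [hk, h]
  have hjk : ⟪j, k⟫_ℝ = 0 := by
    have h := hright j e i
    rw [hl, real_inner_comm i e, hie, mul_zero] at h
    rw [hk, h]
  have t1 : m i i = -e := by rw [hsquare i hie, hi, one_smul]
  have t2 : m j j = -e := by rw [hsquare j hje, hj, one_smul]
  have t3 : m k k = -e := by rw [hsquare k hke, hkk, one_smul]
  have t4 : m i j = k := hk.symm
  have t5 : m j i = -k := by rw [hanti i j hie hje hij, t4]
  have t6 : m i k = -j := by rw [hk, hll i j hie, hi, one_smul]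
  have t7 : m k i = j := by rw [hanti i k hie hke hik, t6, neg_neg]
  have t8 : m k j = -i := by rw [hk, hrr j i hje, hj, one_smul]
  have t9 : m j k = i := by
    rw [hanti k j hke hje (by rw [real_inner_comm, hjk]), t8, neg_neg]
  let f₀ : ℍ[ℝ] →ₗ[ℝ] E :=
    { toFun := fun q => q.re • e + q.imI • i + q.imJ • j + q.imK • k
      map_add' := fun x y => by
        simp only [Quaternion.re_add, Quaternion.imI_add, Quaternion.imJ_add, Quaternion.imK_add]
        module
      map_smul' := fun c x => by
        simp only [Quaternion.re_smul, Quaternion.imI_smul, Quaternion.imJ_smul,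
          Quaternion.imK_smul, smul_eq_mul, RingHom.id_apply]
        module }
  have hf₀ : ∀ q, f₀ q = q.re • e + q.imI • i + q.imJ • j + q.imK • k := fun _ => rfl
  have hnorm : ∀ q, ‖f₀ q‖ = ‖q‖ := fun q => by
    rw [← sq_eq_sq₀ (norm_nonneg _) (norm_nonneg _), ← real_inner_self_eq_norm_sq, sq ‖q‖,
      ← Quaternion.normSq_eq_norm_mul_self, Quaternion.normSq_def', hf₀]
    simp only [inner_add_left, inner_add_right, real_inner_smul_left, real_inner_smul_right,
      hee, hi, hj, hkk, hie, hje, hke, hij, hik, hjk, real_inner_comm i e, real_inner_comm j e,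
      real_inner_comm k e, real_inner_comm i j, real_inner_comm i k, real_inner_comm j k]
    ring
  let f₁ : ℍ[ℝ] →ₗᵢ[ℝ] E := ⟨f₀, hnorm⟩
  refine ⟨f₁.toLinearIsometryEquiv (by rw [Quaternion.finrank_eq_four, h4]), fun x y => ?_⟩
  change f₀ (x * y) = m (f₀ x) (f₀ y)
  simp only [hf₀, map_add, map_smul, LinearMap.add_apply, LinearMap.smul_apply, hl, hr, t1, t2,
    t3, t4, t5, t6, t7, t8, t9, Quaternion.re_mul, Quaternion.imI_mul, Quaternion.imJ_mul,
    Quaternion.imK_mul]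
  module

end Hurwitz

/-! ### Linear isometries of the quaternions -/

section Orthogonal
open scoped InnerProductSpace

/-- The reflection in the hyperplane orthogonal to a unit quaternion `u` is `x ↦ -u x̄ u`. -/
theorem reflection_orthogonal_smul_unitQuaternion {r : ℝ} (hr : r ≠ 0) (u : UnitQuaternion)
    (x : ℍ[ℝ]) : (ℝ ∙ (r • (u : ℍ[ℝ])))ᗮ.reflection x = -(u : ℍ[ℝ]) * star x * u := by
  rw [Submodule.reflection_orthogonal_apply, Submodule.reflection_singleton_apply]
  have h1 : (2 * ⟪(u : ℍ[ℝ]), x⟫_ℝ : ℝ) • (1 : ℍ[ℝ]) = u * star x + x * star (u : ℍ[ℝ]) := by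
    have := Quaternion.self_add_star ((u : ℍ[ℝ]) * star x)
    rw [star_mul, star_star] at this
    rw [this, Quaternion.inner_def, ← Quaternion.coe_mul_eq_smul, mul_one, two_mul, two_mul,
      Quaternion.coe_add]
  have h2 := congrArg (· * (u : ℍ[ℝ])) h1
  simp only [add_mul, smul_mul_assoc, one_mul, mul_assoc, UnitQuaternion.star_coe,
    UnitQuaternion.inv_mul_cancel, mul_one] at h2
  have hu : ‖(u : ℍ[ℝ])‖ = 1 := norm_eq_of_mem_sphere u
  have h3 : (⟪r • (u : ℍ[ℝ]), x⟫_ℝ / (‖r • (u : ℍ[ℝ])‖ : ℝ) ^ 2) • r • (u : ℍ[ℝ]) =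
      ⟪(u : ℍ[ℝ]), x⟫_ℝ • (u : ℍ[ℝ]) := by
    rw [norm_smul, hu, mul_one, Real.norm_eq_abs, sq_abs, real_inner_smul_left, smul_smul]
    congr 1
    field_simp
  have h4 : (u : ℍ[ℝ]) * (star x * u) = (2 * ⟪(u : ℍ[ℝ]), x⟫_ℝ) • (u : ℍ[ℝ]) - x :=
    eq_sub_of_add_eq h2.symm
  rw [neg_mul, neg_mul, mul_assoc, h4, mul_smul, two_smul, ← h3, two_smul]
  rfl

/-- Every linear isometry of the quaternions is `x ↦ a x b` or `x ↦ a x̄ b` with unit quaternions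
`a`, `b`, because the orthogonal group is generated by reflections. -/
theorem linearIsometry_quaternion (f : ℍ[ℝ] ≃ₗᵢ[ℝ] ℍ[ℝ]) : ∃ a b : UnitQuaternion,
    (∀ x, f x = a * x * b) ∨ ∀ x, f x = a * star x * b := by
  have hf : f ∈ Subgroup.closure (Set.range fun v : ℍ[ℝ] => (ℝ ∙ v)ᗮ.reflection) := by
    rw [LinearIsometryEquiv.reflections_generate]; trivial
  induction hf using Subgroup.closure_induction with
  | mem f hf =>
    obtain ⟨v, rfl⟩ := hf
    rcases eq_or_ne v 0 with rfl | hv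
    · refine ⟨1, 1, .inl fun x => ?_⟩
      change (ℝ ∙ (0 : ℍ[ℝ]))ᗮ.reflection x = _
      rw [Submodule.reflection_orthogonal_apply, Submodule.reflection_singleton_apply]
      simp
    · have hv' : ‖v‖ ≠ 0 := norm_ne_zero_iff.2 hv
      obtain ⟨u, hu⟩ : ∃ u : UnitQuaternion, v = ‖v‖ • (u : ℍ[ℝ]) :=
        ⟨⟨‖v‖⁻¹ • v, by simp [norm_smul, hv]⟩, (smul_inv_smul₀ hv' v).symm⟩
      obtain ⟨r, hr⟩ : ∃ r, r = ‖v‖ := ⟨_, rfl⟩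
      rw [← hr] at hu hv'
      subst hu
      exact ⟨-u, u, .inr fun x => reflection_orthogonal_smul_unitQuaternion hv' u x⟩
  | one => exact ⟨1, 1, .inl fun x => by simp⟩
  | mul f g _ _ hf hg =>
    obtain ⟨a, b, hf⟩ := hf
    obtain ⟨c, d, hg⟩ := hg
    rcases hf with hf | hf <;> rcases hg with hg | hg
    · exact ⟨a * c, d * b, .inl fun x => by simp [hf, hg, mul_assoc]⟩
    · exact ⟨a * c, d * b, .inr fun x => by simp [hf, hg, mul_assoc]⟩
    · exact ⟨a * d⁻¹, c⁻¹ * b, .inr fun x => by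
        simp [hf, hg, mul_assoc, UnitQuaternion.star_coe]⟩
    · exact ⟨a * d⁻¹, c⁻¹ * b, .inl fun x => by
        simp [hf, hg, mul_assoc, UnitQuaternion.star_coe]⟩
  | inv f _ hf =>
    obtain ⟨a, b, hf⟩ := hf
    rcases hf with hf | hf
    · refine ⟨a⁻¹, b⁻¹, .inl fun x => f.injective ?_⟩
      rw [LinearIsometryEquiv.coe_inv, LinearIsometryEquiv.apply_symm_apply, hf]
      simp [mul_assoc]
    · refine ⟨b, a, .inr fun x => f.injective ?_⟩
      rw [LinearIsometryEquiv.coe_inv, LinearIsometryEquiv.apply_symm_apply, hf]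
      simp [mul_assoc, UnitQuaternion.star_coe]

end Orthogonal

/-! ### Reduction to principal isotopes -/

namespace PrincipalIsotope
open AbsoluteValuedAlgebra

/-- A four-dimensional absolute-valued algebra is an isotope of the quaternions by two linear
isometries: dividing by the one-sided multiplications by a unit vector produces a unital
algebra. -/
theorem exists_isotope (A : AbsoluteValuedAlgebra.{u}) (h4 : Module.finrank ℝ A = 4) :
    ∃ (f : ℍ[ℝ] ≃ₗ[ℝ] A) (φ ψ : ℍ[ℝ] ≃ₗᵢ[ℝ] ℍ[ℝ]),
      ∀ x y, f (φ x * ψ y) = A.mul (f x) (f y) := by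
  have : FiniteDimensional ℝ A := .of_finrank_pos (by omega)
  have : Nontrivial A := Module.nontrivial_of_finrank_pos (R := ℝ) (by omega)
  let _ : InnerProductSpace ℝ A :=
    InnerProductSpace.ofNorm ℝ (parallelogram_of_norm_mul A.mul A.norm_mul')
  obtain ⟨v, hv⟩ := exists_ne (0 : A)
  obtain ⟨e, he⟩ : ∃ e : A, ‖e‖ = 1 := ⟨‖v‖⁻¹ • v, by simp [norm_smul, hv]⟩
  let L₀ : A →ₗᵢ[ℝ] A := ⟨A.mul e, fun y => by rw [A.norm_mul', he, one_mul]⟩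
  let R₀ : A →ₗᵢ[ℝ] A := ⟨A.mul.flip e, fun y => by
    rw [LinearMap.flip_apply, A.norm_mul', he, mul_one]⟩
  let L := L₀.toLinearIsometryEquiv rfl
  let R := R₀.toLinearIsometryEquiv rfl
  have hL : ∀ x, L x = A.mul e x := fun _ => rfl
  have hR : ∀ x, R x = A.mul x e := fun _ => rfl
  let m : A →ₗ[ℝ] A →ₗ[ℝ] A :=
    A.mul.compl₁₂ (R.symm.toLinearEquiv : A →ₗ[ℝ] A) (L.symm.toLinearEquiv : A →ₗ[ℝ] A)
  have hm : ∀ x y, m x y = A.mul (R.symm x) (L.symm y) := fun _ _ => rfl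
  obtain ⟨f, hf⟩ := exists_quaternion_isometry m
    (fun x y => by rw [hm, A.norm_mul', R.symm.norm_map, L.symm.norm_map]) (A.mul e e)
    (fun x => by rw [hm, ← hR, R.symm_apply_apply, ← hL, L.apply_symm_apply])
    (fun x => by rw [hm, ← hL, L.symm_apply_apply, ← hR, R.apply_symm_apply]) h4
  refine ⟨f.toLinearEquiv, (f.trans R).trans f.symm, (f.trans L).trans f.symm, fun x y => ?_⟩
  refine (hf _ _).trans ?_
  simp [hm]

/-- Every four-dimensional absolute-valued real algebra is a principal isotope of the
quaternions. -/
theorem iso_principalIsotope (A : AbsoluteValuedAlgebra.{u}) (h4 : Module.finrank ℝ A = 4) :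
    ∃ a b : UnitQuaternion, A.Iso (H a b) ∨ A.Iso (starH a b) ∨ A.Iso (Hstar a b) ∨
      A.Iso (starHstar a b) := by
  obtain ⟨f, φ, ψ, hf⟩ := exists_isotope A h4
  have key : ∀ (B : AbsoluteValuedAlgebra.{0}) (g : ℍ[ℝ] ≃ₗ[ℝ] B),
      (∀ x y, g (φ x * ψ y) = B.mul (g x) (g y)) → A.Iso B := fun B g hg =>
    ⟨f.symm.trans g, fun x y => by
      have h := hf (f.symm x) (f.symm y)
      rw [f.apply_symm_apply, f.apply_symm_apply] at h
      simp only [LinearEquiv.trans_apply]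
      rw [← h, f.symm_apply_apply, hg]⟩
  obtain ⟨a, b, hφ⟩ := linearIsometry_quaternion φ
  obtain ⟨c, d, hψ⟩ := linearIsometry_quaternion ψ
  -- translations by unit quaternions absorb two of the four parameters `a, b, c, d`
  rcases hφ with hφ | hφ <;> rcases hψ with hψ | hψ
  · refine ⟨a, (b * c)⁻¹ * d * (b * c), .inl (key _ (sandwich 1 (b * c)) fun x y => ?_)⟩
    rw [hφ, hψ]
    change sandwich 1 (b * c) _ = (a : ℍ[ℝ]) * sandwich 1 (b * c) x * sandwich 1 (b * c) y *
      ((b * c)⁻¹ * d * (b * c) : UnitQuaternion)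
    simp [sandwich_apply, mul_assoc]
  · refine ⟨d⁻¹ * a * d, b * c, .inr (.inr (.inl (key _ (sandwich d⁻¹ 1) fun x y => ?_)))⟩
    rw [hφ, hψ]
    change sandwich d⁻¹ 1 _ = ((d⁻¹ * a * d : UnitQuaternion) : ℍ[ℝ]) * sandwich d⁻¹ 1 x *
      ((b * c : UnitQuaternion) : ℍ[ℝ]) * star (sandwich d⁻¹ 1 y)
    simp [sandwich_apply, mul_assoc, UnitQuaternion.star_coe]
  · refine ⟨b * c, a * d * a⁻¹, .inr (.inl (key _ (sandwich 1 a⁻¹) fun x y => ?_))⟩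
    rw [hφ, hψ]
    change sandwich 1 a⁻¹ _ = star (sandwich 1 a⁻¹ x) * ((b * c : UnitQuaternion) : ℍ[ℝ]) *
      sandwich 1 a⁻¹ y * ((a * d * a⁻¹ : UnitQuaternion) : ℍ[ℝ])
    simp [sandwich_apply, mul_assoc, UnitQuaternion.star_coe]
  · refine ⟨a * (b * c)⁻¹, d * (b * c)⁻¹,
      .inr (.inr (.inr (key _ (sandwich 1 (b * c)⁻¹) fun x y => ?_)))⟩
    rw [hφ, hψ]
    change sandwich 1 (b * c)⁻¹ _ = ((a * (b * c)⁻¹ : UnitQuaternion) : ℍ[ℝ]) *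
      star (sandwich 1 (b * c)⁻¹ x) * star (sandwich 1 (b * c)⁻¹ y) *
        ((d * (b * c)⁻¹ : UnitQuaternion) : ℍ[ℝ])
    simp [sandwich_apply, mul_assoc, UnitQuaternion.star_coe]

end PrincipalIsotope

namespace PrincipalIsotope
open AbsoluteValuedAlgebra

/-! ### Opposite algebras of the starred isotopes -/

section Opposite
variable {a b : UnitQuaternion}

theorem Hstar_op_iso (a b : UnitQuaternion) : (Hstar a b).op.Iso (starH b⁻¹ a⁻¹) := by
  have h := (starH_op_iso b⁻¹ a⁻¹).op
  rw [inv_inv, inv_inv] at h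
  exact h.symm

theorem Hstar_satisfies_op {p q r : ℕ} (hp : p = 1 ∨ p = 2) (hq : q = 1 ∨ q = 2)
    (hr : r = 1 ∨ r = 2) (h : (Hstar a b).Satisfies p q r) :
    (starH b⁻¹ a⁻¹).Satisfies r q p :=
  (Hstar_op_iso a b).satisfies ((op_satisfies _ hr hq hp).2 h)

theorem unitI_inv : (unitI : UnitQuaternion)⁻¹ = -unitI := by
  rw [inv_eq_iff_mul_eq_one]
  refine Subtype.ext ?_
  change (unitI : ℍ[ℝ]) * (-(unitI : ℍ[ℝ])) = 1
  rw [mul_neg, unitI_mul_self, neg_neg]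

/-- Conjugation by `j` inverts `e^{iα}`. -/
theorem starH_expI_inv_iso (α : ℝ) : (starH 1 (expI α)⁻¹).Iso (starH 1 (expI α)) := by
  obtain ⟨g, hg⟩ := UnitQuaternion.exists_of_intertwine (x := quat 0 0 1 0)
    (by simp [quat.eq_zero_iff])
  have h := starH_iso_conj 1 (expI α)⁻¹ g
  have h1 : g * (expI α)⁻¹ * g⁻¹ = expI α := by
    rw [mul_inv_eq_iff_eq_mul]
    refine Subtype.ext (hg _ _ ?_)
    rw [Metric.unitSphere.coe_inv, ← UnitQuaternion.star_coe, coe_expI]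
    simp only [quat.star, quat.mul, quat.inj]
    refine ⟨?_, ?_, ?_, ?_⟩ <;> ring
  rw [h1, mul_one, mul_inv_cancel] at h
  exact h

theorem starH_expI_op_iso (α : ℝ) : (starH 1 (expI α)).op.Iso (Hstar (expI α) 1) := by
  have h := (starH_expI_inv_iso α).op.symm.trans (starH_op_iso 1 (expI α)⁻¹)
  rwa [inv_inv, inv_one] at h

theorem starH_unitI_one_op_iso : (starH unitI 1).op.Iso (Hstar 1 unitI) := by
  have h := (starH_iso_neg_left unitI 1).op.trans (starH_op_iso (-unitI) 1)
  rwa [← unitI_inv, inv_inv, inv_one] at h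

theorem starH_unitI_unitI_op_iso : (starH unitI unitI).op.Iso (Hstar unitI unitI) := by
  have h := ((starH_iso_neg_left unitI unitI).trans (starH_iso_neg_right _ _)).op.trans
    (starH_op_iso (-unitI) (-unitI))
  rwa [← unitI_inv, inv_inv] at h

theorem starH_one_one_op_iso : (starH 1 1).op.Iso (Hstar 1 1) := by
  simpa only [inv_one] using starH_op_iso 1 1

end Opposite

/-! ### The algebras that satisfy an identity -/

theorem op_iso_iff {A : AbsoluteValuedAlgebra.{u}} {B : AbsoluteValuedAlgebra.{v}}
    {C : AbsoluteValuedAlgebra.{w}} (h : B.op.Iso C) : A.Iso C ↔ A.op.Iso B :=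
  ⟨fun k => (k.trans h.symm).op, fun k => Iso.trans (B := B.op) k.op h⟩

variable (A : AbsoluteValuedAlgebra.{u}) (h4 : Module.finrank ℝ A = 4)
include h4

theorem satisfies_111_iff : A.Satisfies 1 1 1 ↔ A.Iso (H 1 1) ∨ A.Iso (starHstar 1 1) := by
  constructor
  · intro h
    obtain ⟨a, b, e | e | e | e⟩ := iso_principalIsotope A h4
    · exact .inl (e.trans (H_iso_one (.inl rfl) (.inl rfl) (.inl rfl) (e.satisfies h)))
    · exact (not_starH_satisfies_111 (e.satisfies h)).elim
    · exact (not_starH_satisfies_111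
        (Hstar_satisfies_op (.inl rfl) (.inl rfl) (.inl rfl) (e.satisfies h))).elim
    · exact .inr (e.trans (starHstar_iso_one_of_palindrome (.inl rfl) (.inl rfl)
        (e.satisfies h)))
  · rintro (e | e)
    · exact e.symm.satisfies (H_one_satisfies _ _ _)
    · exact e.symm.satisfies (starHstar_one_satisfies (.inl rfl) (.inl rfl))

theorem satisfies_121_iff : A.Satisfies 1 2 1 ↔ A.Iso (H 1 1) ∨ A.Iso (starHstar 1 1) := by
  constructor
  · intro h
    obtain ⟨a, b, e | e | e | e⟩ := iso_principalIsotope A h4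
    · exact .inl (e.trans (H_iso_one (.inl rfl) (.inr rfl) (.inl rfl) (e.satisfies h)))
    · exact (not_starH_satisfies_121 (e.satisfies h)).elim
    · exact (not_starH_satisfies_121
        (Hstar_satisfies_op (.inl rfl) (.inr rfl) (.inl rfl) (e.satisfies h))).elim
    · exact .inr (e.trans (starHstar_iso_one_of_palindrome (.inl rfl) (.inr rfl)
        (e.satisfies h)))
  · rintro (e | e)
    · exact e.symm.satisfies (H_one_satisfies _ _ _)
    · exact e.symm.satisfies (starHstar_one_satisfies (.inl rfl) (.inr rfl))

theorem satisfies_211_iff : A.Satisfies 2 1 1 ↔ A.Iso (H 1 1) ∨ A.Iso (starH 1 1) := by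
  constructor
  · intro h
    obtain ⟨a, b, e | e | e | e⟩ := iso_principalIsotope A h4
    · exact .inl (e.trans (H_iso_one (.inr rfl) (.inl rfl) (.inl rfl) (e.satisfies h)))
    · exact .inr (e.trans (starH_iso_one_of_211 (e.satisfies h)))
    · exact (not_starH_satisfies_112
        (Hstar_satisfies_op (.inr rfl) (.inl rfl) (.inl rfl) (e.satisfies h))).elim
    · exact (not_starHstar_satisfies_211 (e.satisfies h)).elim
  · rintro (e | e)
    · exact e.symm.satisfies (H_one_satisfies _ _ _)
    · exact e.symm.satisfies starH_one_one_satisfies_211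

theorem satisfies_221_iff : A.Satisfies 2 2 1 ↔
    A.Iso (H 1 1) ∨ A.Iso (starH 1 1) ∨ A.Iso (starH unitI 1) := by
  constructor
  · intro h
    obtain ⟨a, b, e | e | e | e⟩ := iso_principalIsotope A h4
    · exact .inl (e.trans (H_iso_one (.inr rfl) (.inr rfl) (.inl rfl) (e.satisfies h)))
    · exact .inr ((starH_iso_of_221 (e.satisfies h)).imp e.trans e.trans)
    · exact (not_starH_satisfies_122
        (Hstar_satisfies_op (.inr rfl) (.inr rfl) (.inl rfl) (e.satisfies h))).elim
    · exact (not_starHstar_satisfies_221 (e.satisfies h)).elim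
  · rintro (e | e | e)
    · exact e.symm.satisfies (H_one_satisfies _ _ _)
    · exact e.symm.satisfies starH_one_one_satisfies_221
    · exact e.symm.satisfies starH_unitI_one_satisfies_221

theorem satisfies_112_iff : A.Satisfies 1 1 2 ↔ A.Iso (H 1 1) ∨ A.Iso (Hstar 1 1) := by
  rw [op_iso_iff H_one_op_iso, op_iso_iff starH_one_one_op_iso, ← satisfies_211_iff A.op h4,
    op_satisfies _ (.inr rfl) (.inl rfl) (.inl rfl)]

theorem satisfies_122_iff : A.Satisfies 1 2 2 ↔
    A.Iso (H 1 1) ∨ A.Iso (Hstar 1 1) ∨ A.Iso (Hstar 1 unitI) := by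
  rw [op_iso_iff H_one_op_iso, op_iso_iff starH_one_one_op_iso,
    op_iso_iff starH_unitI_one_op_iso, ← satisfies_221_iff A.op h4,
    op_satisfies _ (.inr rfl) (.inr rfl) (.inl rfl)]

theorem satisfies_212_iff : A.Satisfies 2 1 2 ↔
    A.Iso (H 1 1) ∨ A.Iso (starHstar 1 1) ∨
    (∃ α ∈ Set.Ico 0 Real.pi, A.Iso (starH 1 (expI α))) ∨
    (∃ α ∈ Set.Ico 0 Real.pi, A.Iso (Hstar (expI α) 1)) := by
  constructor
  · intro h
    obtain ⟨a, b, e | e | e | e⟩ := iso_principalIsotope A h4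
    · exact .inl (e.trans (H_iso_one (.inr rfl) (.inl rfl) (.inr rfl) (e.satisfies h)))
    · obtain ⟨α, hα, e'⟩ := starH_iso_of_212 (e.satisfies h)
      exact .inr (.inr (.inl ⟨α, hα, e.trans e'⟩))
    · obtain ⟨α, hα, e'⟩ := starH_iso_of_212
        (Hstar_satisfies_op (.inr rfl) (.inl rfl) (.inr rfl) (e.satisfies h))
      exact .inr (.inr (.inr ⟨α, hα,
        (op_iso_iff (starH_expI_op_iso α)).2 ((e.op.trans (Hstar_op_iso a b)).trans e')⟩))
    · exact .inr (.inl (e.trans (starHstar_iso_one_of_palindrome (.inr rfl) (.inl rfl)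
        (e.satisfies h))))
  · rintro (e | e | ⟨α, -, e⟩ | ⟨α, -, e⟩)
    · exact e.symm.satisfies (H_one_satisfies _ _ _)
    · exact e.symm.satisfies (starHstar_one_satisfies (.inr rfl) (.inl rfl))
    · exact e.symm.satisfies (starH_one_satisfies_212 _)
    · exact (e.trans (starH_expI_op_iso α).symm).symm.satisfies
        ((op_satisfies _ (.inr rfl) (.inl rfl) (.inr rfl)).2 (starH_one_satisfies_212 _))

theorem satisfies_222_iff : A.Satisfies 2 2 2 ↔
    A.Iso (H 1 1) ∨ A.Iso (starHstar 1 1) ∨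
    A.Iso (starH unitI 1) ∨ A.Iso (starH unitI unitI) ∨
    A.Iso (Hstar 1 unitI) ∨ A.Iso (Hstar unitI unitI) ∨
    (∃ α ∈ Set.Ico 0 Real.pi, A.Iso (starH 1 (expI α))) ∨
    (∃ α ∈ Set.Ico 0 Real.pi, A.Iso (Hstar (expI α) 1)) := by
  constructor
  · intro h
    obtain ⟨a, b, e | e | e | e⟩ := iso_principalIsotope A h4
    · exact .inl (e.trans (H_iso_one (.inr rfl) (.inr rfl) (.inr rfl) (e.satisfies h)))
    · rcases starH_iso_of_222 (e.satisfies h) with e' | e' | ⟨α, hα, e'⟩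
      · exact .inr (.inr (.inl (e.trans e')))
      · exact .inr (.inr (.inr (.inl (e.trans e'))))
      · exact .inr (.inr (.inr (.inr (.inr (.inr (.inl ⟨α, hα, e.trans e'⟩))))))
    · have eop := e.op.trans (Hstar_op_iso a b)
      rcases starH_iso_of_222
        (Hstar_satisfies_op (.inr rfl) (.inr rfl) (.inr rfl) (e.satisfies h)) with
        e' | e' | ⟨α, hα, e'⟩
      · exact .inr (.inr (.inr (.inr (.inl
          ((op_iso_iff starH_unitI_one_op_iso).2 (eop.trans e'))))))
      · exact .inr (.inr (.inr (.inr (.inr (.inl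
          ((op_iso_iff starH_unitI_unitI_op_iso).2 (eop.trans e')))))))
      · exact .inr (.inr (.inr (.inr (.inr (.inr (.inr ⟨α, hα,
          (op_iso_iff (starH_expI_op_iso α)).2 (eop.trans e')⟩))))))
    · exact .inr (.inl (e.trans (starHstar_iso_one_of_palindrome (.inr rfl) (.inr rfl)
        (e.satisfies h))))
  · have hop : ∀ {B C : AbsoluteValuedAlgebra.{0}}, B.op.Iso C → B.Satisfies 2 2 2 →
        A.Iso C → A.Satisfies 2 2 2 := fun hBC hB e =>
      (e.trans hBC.symm).symm.satisfies ((op_satisfies _ (.inr rfl) (.inr rfl) (.inr rfl)).2 hB)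
    rintro (e | e | e | e | e | e | ⟨α, -, e⟩ | ⟨α, -, e⟩)
    · exact e.symm.satisfies (H_one_satisfies _ _ _)
    · exact e.symm.satisfies (starHstar_one_satisfies (.inr rfl) (.inr rfl))
    · exact e.symm.satisfies starH_unitI_one_satisfies_222
    · exact e.symm.satisfies starH_unitI_unitI_satisfies_222
    · exact hop starH_unitI_one_op_iso starH_unitI_one_satisfies_222 e
    · exact hop starH_unitI_unitI_op_iso starH_unitI_unitI_satisfies_222 e
    · exact e.symm.satisfies (starH_one_satisfies_222 _)
    · exact hop (starH_expI_op_iso α) (starH_one_satisfies_222 _) e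

end PrincipalIsotope

/-! ### Isomorphism invariants and the number of isomorphism classes -/

namespace AbsoluteValuedAlgebra

theorem not_iso_of_satisfies {B : AbsoluteValuedAlgebra.{u}} {C : AbsoluteValuedAlgebra.{v}}
    (p q r : ℕ) (hB : B.Satisfies p q r) (hC : ¬ C.Satisfies p q r) : ¬ B.Iso C :=
  fun h => hC (h.satisfies hB)

theorem not_iso_of_not_satisfies {B : AbsoluteValuedAlgebra.{u}}
    {C : AbsoluteValuedAlgebra.{v}} (p q r : ℕ) (hB : ¬ B.Satisfies p q r)
    (hC : C.Satisfies p q r) : ¬ B.Iso C :=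
  fun h => hB (h.symm.satisfies hC)

/-- An isomorphism preserves the traces of left multiplications. -/
theorem trace_mul_map {B : AbsoluteValuedAlgebra.{u}} {C : AbsoluteValuedAlgebra.{v}}
    (f : B ≃ₗ[ℝ] C) (hf : ∀ x y : B, f (B.mul x y) = C.mul (f x) (f y)) (x : B) :
    LinearMap.trace ℝ C (C.mul (f x)) = LinearMap.trace ℝ B (B.mul x) := by
  rw [← LinearMap.trace_conj' (B.mul x) f]
  congr 1
  ext y
  rw [LinearEquiv.conj_apply_apply, hf, f.apply_symm_apply]

/-- A copy of an absolute-valued algebra in a higher universe. It lets the quaternionic isotopes,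
which live in the lowest universe, represent isomorphism classes in every universe. -/
def ulift (A : AbsoluteValuedAlgebra.{v}) : AbsoluteValuedAlgebra.{max u v} where
  carrier := ULift.{u} A
  mul := (A.mul.compl₁₂ (ULift.moduleEquiv : ULift.{u} A ≃ₗ[ℝ] A).toLinearMap
    (ULift.moduleEquiv : ULift.{u} A ≃ₗ[ℝ] A).toLinearMap).compr₂
      (ULift.moduleEquiv : ULift.{u} A ≃ₗ[ℝ] A).symm.toLinearMap
  norm_mul' x y := A.norm_mul' x.down y.down

theorem iso_ulift (A : AbsoluteValuedAlgebra.{v}) : A.Iso (ulift.{u} A) :=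
  ⟨(ULift.moduleEquiv : ULift.{u} A ≃ₗ[ℝ] A).symm, fun _ _ => rfl⟩

theorem Iso.finrank_eq {A : AbsoluteValuedAlgebra.{u}} {B : AbsoluteValuedAlgebra.{v}}
    (h : A.Iso B) : Module.finrank ℝ A = Module.finrank ℝ B :=
  h.elim fun f _ => f.finrank_eq

/-- The isomorphism class, in an arbitrary universe, of an algebra in the lowest universe. -/
def isoClass {p q r : ℕ} (A : AbsoluteValuedAlgebra.{0}) (h4 : Module.finrank ℝ A = 4)
    (hA : A.Satisfies p q r) : Quotient (isoSetoid.{u} p q r) :=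
  Quotient.mk _ ⟨ulift.{u} A, (iso_ulift.{u} A).finrank_eq.symm.trans h4,
    (iso_ulift.{u} A).satisfies hA⟩

theorem isoClass_eq_iff {p q r : ℕ} {A B : AbsoluteValuedAlgebra.{0}}
    {h4 : Module.finrank ℝ A = 4} {h4' : Module.finrank ℝ B = 4}
    {hA : A.Satisfies p q r} {hB : B.Satisfies p q r} :
    isoClass.{u} A h4 hA = isoClass.{u} B h4' hB ↔ A.Iso B := by
  refine Quotient.eq.trans ⟨fun h => ?_, fun h => ?_⟩
  · exact ((iso_ulift.{u} A).trans h).trans (iso_ulift.{u} B).symm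
  · exact ((iso_ulift.{u} A).symm.trans h).trans (iso_ulift.{u} B)

/-- A complete irredundant list of representatives counts the isomorphism classes. -/
theorem numIsoClasses_eq {p q r n : ℕ} (F : Fin n → AbsoluteValuedAlgebra.{0})
    (h4 : ∀ i, Module.finrank ℝ (F i) = 4) (hF : ∀ i, (F i).Satisfies p q r)
    (hinj : ∀ i j, i < j → ¬ (F i).Iso (F j))
    (hsurj : ∀ A : AbsoluteValuedAlgebra.{u}, Module.finrank ℝ A = 4 → A.Satisfies p q r →
      ∃ i, A.Iso (F i)) : numIsoClasses.{u} p q r = n := by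
  have hbij : Function.Bijective fun i : Fin n => isoClass.{u} (F i) (h4 i) (hF i) := by
    refine ⟨fun i j hij => ?_, fun x => ?_⟩
    · have h := isoClass_eq_iff.1 hij
      rcases lt_trichotomy i j with hlt | rfl | hlt
      · exact (hinj i j hlt h).elim
      · rfl
      · exact (hinj j i hlt h.symm).elim
    · induction x using Quotient.inductionOn with
      | h A =>
        obtain ⟨i, hi⟩ := hsurj A.1 A.2.1 A.2.2
        exact ⟨i, Quotient.sound ((iso_ulift.{u} (F i)).symm.trans hi.symm)⟩
  rw [numIsoClasses, ← ENat.card_congr (Equiv.ofBijective _ hbij)]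
  simp

theorem numIsoClasses_eq_top {p q r : ℕ} {ι : Type*} [Infinite ι]
    (F : ι → AbsoluteValuedAlgebra.{0}) (h4 : ∀ i, Module.finrank ℝ (F i) = 4)
    (hF : ∀ i, (F i).Satisfies p q r) (hinj : ∀ i j, (F i).Iso (F j) → i = j) :
    numIsoClasses.{u} p q r = ⊤ := by
  have : Infinite (Quotient (isoSetoid.{u} p q r)) :=
    Infinite.of_injective (fun i : ι => isoClass.{u} (F i) (h4 i) (hF i))
      fun i j hij => hinj i j (isoClass_eq_iff.1 hij)
  exact ENat.card_eq_top_of_infinite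

end AbsoluteValuedAlgebra

namespace PrincipalIsotope
open AbsoluteValuedAlgebra

theorem H_finrank (a b : UnitQuaternion) : Module.finrank ℝ (H a b) = 4 :=
  Quaternion.finrank_eq_four

theorem starH_finrank (a b : UnitQuaternion) : Module.finrank ℝ (starH a b) = 4 :=
  Quaternion.finrank_eq_four

theorem Hstar_finrank (a b : UnitQuaternion) : Module.finrank ℝ (Hstar a b) = 4 :=
  Quaternion.finrank_eq_four

theorem starHstar_finrank (a b : UnitQuaternion) : Module.finrank ℝ (starHstar a b) = 4 :=
  Quaternion.finrank_eq_four

/-! ### Identities that fail -/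

theorem not_Hstar_satisfies_111 {a b : UnitQuaternion} : ¬ (Hstar a b).Satisfies 1 1 1 := fun h =>
  not_starH_satisfies_111 (Hstar_satisfies_op (.inl rfl) (.inl rfl) (.inl rfl) h)

theorem not_Hstar_satisfies_221 {a b : UnitQuaternion} : ¬ (Hstar a b).Satisfies 2 2 1 := fun h =>
  not_starH_satisfies_122 (Hstar_satisfies_op (.inr rfl) (.inr rfl) (.inl rfl) h)

theorem normalPosition_unitI_one : NormalPosition unitI 1 0 1 1 0 0 :=
  ⟨coe_unitI, by ext <;> simp⟩

theorem normalPosition_unitI_unitI : NormalPosition unitI unitI 0 1 0 1 0 :=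
  ⟨coe_unitI, coe_unitI⟩

theorem not_starH_unitI_one_satisfies_211 : ¬ (starH unitI 1).Satisfies 2 1 1 := fun h =>
  one_ne_zero (starH_satisfies_211_of_normal normalPosition_unitI_one h).1

theorem not_starH_unitI_one_satisfies_212 : ¬ (starH unitI 1).Satisfies 2 1 2 := fun h =>
  one_ne_zero (starH_satisfies_212_of_normal normalPosition_unitI_one h)

theorem not_starH_unitI_unitI_satisfies_212 : ¬ (starH unitI unitI).Satisfies 2 1 2 := fun h =>
  one_ne_zero (starH_satisfies_212_of_normal normalPosition_unitI_unitI h)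

theorem not_starH_unitI_unitI_satisfies_221 : ¬ (starH unitI unitI).Satisfies 2 2 1 := fun h =>
  one_ne_zero (starH_satisfies_221_of_normal normalPosition_unitI_unitI h).1

theorem Hstar_one_unitI_satisfies_iff {p q r : ℕ} (hp : p = 1 ∨ p = 2) (hq : q = 1 ∨ q = 2)
    (hr : r = 1 ∨ r = 2) :
    (Hstar 1 unitI).Satisfies p q r ↔ (starH unitI 1).Satisfies r q p := by
  rw [← starH_unitI_one_op_iso.satisfies_iff, op_satisfies _ hp hq hr]

theorem Hstar_unitI_unitI_satisfies_iff {p q r : ℕ} (hp : p = 1 ∨ p = 2) (hq : q = 1 ∨ q = 2)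
    (hr : r = 1 ∨ r = 2) :
    (Hstar unitI unitI).Satisfies p q r ↔ (starH unitI unitI).Satisfies r q p := by
  rw [← starH_unitI_unitI_op_iso.satisfies_iff, op_satisfies _ hp hq hr]

theorem Hstar_one_one_satisfies_iff {p q r : ℕ} (hp : p = 1 ∨ p = 2) (hq : q = 1 ∨ q = 2)
    (hr : r = 1 ∨ r = 2) :
    (Hstar 1 1).Satisfies p q r ↔ (starH 1 1).Satisfies r q p := by
  rw [← starH_one_one_op_iso.satisfies_iff, op_satisfies _ hp hq hr]

theorem Hstar_expI_satisfies_212 (α : ℝ) : (Hstar (expI α) 1).Satisfies 2 1 2 :=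
  (starH_expI_op_iso α).satisfies
    ((op_satisfies _ (.inr rfl) (.inl rfl) (.inr rfl)).2 (starH_one_satisfies_212 _))

/-! ### Non-isomorphic isotopes -/

theorem trace_quaternion (f : ℍ[ℝ] →ₗ[ℝ] ℍ[ℝ]) : LinearMap.trace ℝ ℍ[ℝ] f =
    (f (quat 1 0 0 0)).re + (f (quat 0 1 0 0)).imI + (f (quat 0 0 1 0)).imJ +
      (f (quat 0 0 0 1)).imK := by
  let e : Module.Basis (Fin 4) ℝ ℍ[ℝ] :=
    QuaternionAlgebra.basisOneIJK (-1 : ℝ) 0 (-1)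
  have he : ∀ q : ℍ[ℝ], ⇑(e.repr q) = ![q.re, q.imI, q.imJ, q.imK] := fun q =>
    QuaternionAlgebra.coe_basisOneIJK_repr (-1 : ℝ) 0 (-1) q
  have he' : ∀ q : ℍ[ℝ], ∀ i, e.repr q = Finsupp.single i 1 → e i = q := fun q i h => by
    rw [← e.repr_symm_single_one, ← h, e.repr.symm_apply_apply]
  have e0 : e 0 = quat 1 0 0 0 := he' _ 0 <| DFunLike.coe_injective <| by
    rw [he]; ext i; fin_cases i <;> simp
  have e1 : e 1 = quat 0 1 0 0 := he' _ 1 <| DFunLike.coe_injective <| by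
    rw [he]; ext i; fin_cases i <;> simp
  have e2 : e 2 = quat 0 0 1 0 := he' _ 2 <| DFunLike.coe_injective <| by
    rw [he]; ext i; fin_cases i <;> simp
  have e3 : e 3 = quat 0 0 0 1 := he' _ 3 <| DFunLike.coe_injective <| by
    rw [he]; ext i; fin_cases i <;> simp
  rw [LinearMap.trace_eq_matrix_trace ℝ e, Matrix.trace, Fin.sum_univ_four]
  simp only [Matrix.diag_apply, LinearMap.toMatrix_apply, he, e0, e1, e2, e3]
  rfl

/-- The left multiplication `y ↦ x̄ a y b` has trace `4 Re(x̄ a) Re(b)`. -/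
theorem trace_starH (a b : UnitQuaternion) (x : ℍ[ℝ]) :
    LinearMap.trace ℝ (starH a b) ((starH a b).mul x) =
      4 * (star x * a).re * (b : ℍ[ℝ]).re := by
  refine (trace_quaternion _).trans ?_
  change (star x * a * quat 1 0 0 0 * b : ℍ[ℝ]).re + (star x * a * quat 0 1 0 0 * b : ℍ[ℝ]).imI +
    (star x * a * quat 0 0 1 0 * b : ℍ[ℝ]).imJ + (star x * a * quat 0 0 0 1 * b : ℍ[ℝ]).imK = _
  generalize star x * (a : ℍ[ℝ]) = p
  obtain ⟨b, -⟩ := b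
  dsimp only
  simp
  ring

/-- Left multiplications in `*ℍ(i,i)` have trace `0`, while left multiplication by `1` in `ℍ*(i,i)`
is `y ↦ -ȳ`, of trace `2`. -/
theorem not_starH_unitI_unitI_iso_Hstar : ¬ (starH unitI unitI).Iso (Hstar unitI unitI) := by
  rintro ⟨f, hf⟩
  obtain ⟨x, hx⟩ := f.surjective (1 : ℍ[ℝ])
  have h := trace_mul_map f hf x
  have h1 : LinearMap.trace ℝ (Hstar unitI unitI) ((Hstar unitI unitI).mul (1 : ℍ[ℝ])) = 2 := by
    refine (trace_quaternion _).trans ?_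
    change (unitI * 1 * unitI * star (quat 1 0 0 0) : ℍ[ℝ]).re +
      (unitI * 1 * unitI * star (quat 0 1 0 0) : ℍ[ℝ]).imI +
      (unitI * 1 * unitI * star (quat 0 0 1 0) : ℍ[ℝ]).imJ +
      (unitI * 1 * unitI * star (quat 0 0 0 1) : ℍ[ℝ]).imK = 2
    simp only [mul_one, coe_unitI, quat.mul, quat.star]
    norm_num
  rw [hx] at h
  have h2 := (h1.symm.trans h).trans (trace_starH unitI unitI x)
  simp [coe_unitI] at h2

/-- `b` is the only nonzero idempotent of `*ℍ(1,b)`. -/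
theorem starH_one_idempotent {b : UnitQuaternion} {x : ℍ[ℝ]} (hx : x ≠ 0)
    (h : (starH 1 b).mul x x = x) : x = b := by
  have h' : Quaternion.normSq x • (b : ℍ[ℝ]) = x := (starH_one_pow_two b x).symm.trans h
  have hn := congrArg norm h'
  rw [norm_smul, norm_eq_of_mem_sphere, mul_one, Real.norm_eq_abs,
    Quaternion.normSq_eq_norm_mul_self, abs_mul_self] at hn
  have h1 : ‖x‖ = 1 := (mul_eq_left₀ (norm_ne_zero_iff.2 hx)).1 hn
  rw [Quaternion.normSq_eq_norm_mul_self, h1] at h'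
  simpa using h'.symm

/-- The trace of left multiplication by the unique nonzero idempotent `e^{iα}` is `4 cos² α`. -/
theorem cos_sq_eq_of_iso {α β : ℝ} (h : (starH 1 (expI α)).Iso (starH 1 (expI β))) :
    Real.cos α ^ 2 = Real.cos β ^ 2 := by
  obtain ⟨f, hf⟩ := h
  have hα : (starH 1 (expI α)).mul (expI α : ℍ[ℝ]) (expI α : ℍ[ℝ]) = (expI α : ℍ[ℝ]) := by
    change star (expI α : ℍ[ℝ]) * (1 : ℍ[ℝ]) * (expI α : ℍ[ℝ]) * (expI α : ℍ[ℝ]) = _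
    simp [UnitQuaternion.star_coe]
  have hne : f (expI α : ℍ[ℝ]) ≠ 0 := fun h0 =>
    (expI α).coe_ne_zero ((map_eq_zero_iff f f.injective).1 h0)
  have hβ : f (expI α : ℍ[ℝ]) = (expI β : ℍ[ℝ]) :=
    starH_one_idempotent hne ((hf _ _).symm.trans (congrArg f hα))
  have ht := trace_mul_map f hf (expI α : ℍ[ℝ])
  rw [hβ] at ht
  replace ht := ((trace_starH _ _ _).symm.trans ht).trans (trace_starH _ _ _)
  change 4 * (star (expI β : ℍ[ℝ]) * (1 : ℍ[ℝ])).re * (expI β : ℍ[ℝ]).re =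
    4 * (star (expI α : ℍ[ℝ]) * (1 : ℍ[ℝ])).re * (expI α : ℍ[ℝ]).re at ht
  rw [mul_one, mul_one, Quaternion.re_star, Quaternion.re_star, coe_expI, coe_expI] at ht
  change 4 * Real.cos β * Real.cos β = 4 * Real.cos α * Real.cos α at ht
  linarith

theorem expI_pi_sub (α : ℝ) : expI (Real.pi - α) = -(expI α)⁻¹ := by
  refine Subtype.ext ?_
  change _ = -(((expI α)⁻¹ : UnitQuaternion) : ℍ[ℝ])
  rw [Metric.unitSphere.coe_inv, ← UnitQuaternion.star_coe, coe_expI, coe_expI, quat.star,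
    Real.cos_pi_sub, Real.sin_pi_sub]
  ext <;> simp

theorem starH_expI_iso_iff {α β : ℝ} (hα : α ∈ Set.Ico 0 Real.pi) (hβ : β ∈ Set.Ico 0 Real.pi) :
    (starH 1 (expI α)).Iso (starH 1 (expI β)) ↔ β = α ∨ β = Real.pi - α := by
  constructor
  · intro h
    have hα' : α ∈ Set.Icc 0 Real.pi := ⟨hα.1, hα.2.le⟩
    have hβ' : β ∈ Set.Icc 0 Real.pi := ⟨hβ.1, hβ.2.le⟩
    rcases sq_eq_sq_iff_eq_or_eq_neg.1 (cos_sq_eq_of_iso h) with h | h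
    · exact .inl (Real.injOn_cos hβ' hα' h.symm)
    · right
      refine Real.injOn_cos hβ' ⟨by linarith [hα.2], by linarith [hα.1]⟩ ?_
      rw [Real.cos_pi_sub, h, neg_neg]
  · rintro (rfl | rfl)
    · exact Iso.refl _
    · rw [expI_pi_sub]
      exact (starH_expI_inv_iso α).symm.trans (starH_iso_neg_right _ _)

theorem Hstar_expI_iso_iff {α β : ℝ} (hα : α ∈ Set.Ico 0 Real.pi) (hβ : β ∈ Set.Ico 0 Real.pi) :
    (Hstar (expI α) 1).Iso (Hstar (expI β) 1) ↔ β = α ∨ β = Real.pi - α := by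
  rw [← starH_expI_iso_iff hα hβ, ← op_iso_op_iff (A := starH 1 (expI α))]
  exact ⟨fun h => ((starH_expI_op_iso α).trans h).trans (starH_expI_op_iso β).symm,
    fun h => ((starH_expI_op_iso α).symm.trans h).trans (starH_expI_op_iso β)⟩

/-- The identity `(xy)(xz) = (xx)(yz)` holds in `*ℍ(1,b)` and fails in `ℍ*(a,1)`. -/
theorem not_starH_one_iso_Hstar_one (a b : UnitQuaternion) : ¬ (starH 1 b).Iso (Hstar a 1) := by
  rintro ⟨f, hf⟩
  have h1 : ∀ x y z : ℍ[ℝ], star (star x * 1 * y * b) * 1 * (star x * 1 * z * b) * b =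
      star (star x * 1 * x * b) * 1 * (star y * 1 * z * b) * b := fun x y z => by
    have hx : ∀ w : ℍ[ℝ], x * (star x * w) = Quaternion.normSq x • w := fun w => by
      rw [← mul_assoc, Quaternion.self_mul_star, Quaternion.coe_mul_eq_smul]
    have hx' : ∀ w : ℍ[ℝ], star x * (x * w) = Quaternion.normSq x • w := fun w => by
      rw [← mul_assoc, Quaternion.star_mul_self, Quaternion.coe_mul_eq_smul]
    simp only [mul_one, star_mul, star_star, Quaternion.star_smul, mul_assoc, hx, hx',
      mul_smul_comm, smul_mul_assoc]
  have h2 : ∀ x y z : ℍ[ℝ], (Hstar a 1).mul ((Hstar a 1).mul x y) ((Hstar a 1).mul x z) =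
      (Hstar a 1).mul ((Hstar a 1).mul x x) ((Hstar a 1).mul y z) := fun x y z => by
    obtain ⟨x, rfl⟩ := f.surjective x
    obtain ⟨y, rfl⟩ := f.surjective y
    obtain ⟨z, rfl⟩ := f.surjective z
    simp only [← hf]
    exact congrArg f (h1 x y z)
  -- the identity at `x = i`, `y = 1`, `z = j`
  have h3 : (a : ℍ[ℝ]) * (a * quat 0 1 0 0 * (1 : ℍ[ℝ]) * star 1) * (1 : ℍ[ℝ]) *
      star (a * quat 0 1 0 0 * (1 : ℍ[ℝ]) * star (quat 0 0 1 0)) =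
      a * (a * quat 0 1 0 0 * (1 : ℍ[ℝ]) * star (quat 0 1 0 0)) * (1 : ℍ[ℝ]) *
        star ((a : ℍ[ℝ]) * 1 * (1 : ℍ[ℝ]) * star (quat 0 0 1 0)) := h2 _ 1 _
  simp only [star_one, mul_one, star_mul, star_star, mul_assoc] at h3
  replace h3 := mul_left_cancel₀ a.coe_ne_zero (mul_left_cancel₀ a.coe_ne_zero h3)
  simp only [← mul_assoc] at h3
  replace h3 := mul_right_cancel₀ (star_ne_zero.2 a.coe_ne_zero) h3
  simp only [quat.mul, quat.star, quat.inj] at h3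
  norm_num at h3

end PrincipalIsotope

/-! ### Irredundance of the list and the numbers of classes -/

namespace PrincipalIsotope
open AbsoluteValuedAlgebra

theorem not_H_one_iso_starHstar (a b : UnitQuaternion) : ¬ (H 1 1).Iso (starHstar a b) :=
  not_iso_of_satisfies 1 1 2 (H_one_satisfies _ _ _) not_starHstar_satisfies_112

theorem not_H_one_iso_starH (a b : UnitQuaternion) : ¬ (H 1 1).Iso (starH a b) :=
  not_iso_of_satisfies 1 1 1 (H_one_satisfies _ _ _) not_starH_satisfies_111

theorem not_H_one_iso_Hstar (a b : UnitQuaternion) : ¬ (H 1 1).Iso (Hstar a b) :=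
  not_iso_of_satisfies 1 1 1 (H_one_satisfies _ _ _) not_Hstar_satisfies_111

theorem not_starHstar_one_iso_starH (a b : UnitQuaternion) : ¬ (starHstar 1 1).Iso (starH a b) :=
  not_iso_of_satisfies 1 1 1 (starHstar_one_satisfies (.inl rfl) (.inl rfl))
    not_starH_satisfies_111

theorem not_starHstar_one_iso_Hstar (a b : UnitQuaternion) : ¬ (starHstar 1 1).Iso (Hstar a b) :=
  not_iso_of_satisfies 1 1 1 (starHstar_one_satisfies (.inl rfl) (.inl rfl))
    not_Hstar_satisfies_111

theorem pairwise_not_iso :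
    [H 1 1, starHstar 1 1, starH unitI 1, starH unitI unitI, Hstar 1 unitI,
      Hstar unitI unitI].Pairwise (fun B C => ¬ B.Iso C) := by
  have h122 : ¬ (starH unitI unitI).Iso (Hstar 1 unitI) :=
    not_iso_of_not_satisfies 1 2 2 not_starH_satisfies_122
      ((Hstar_one_unitI_satisfies_iff (.inl rfl) (.inr rfl) (.inr rfl)).2
        starH_unitI_one_satisfies_221)
  have h122' : ¬ (Hstar 1 unitI).Iso (Hstar unitI unitI) :=
    not_iso_of_satisfies 1 2 2
      ((Hstar_one_unitI_satisfies_iff (.inl rfl) (.inr rfl) (.inr rfl)).2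
        starH_unitI_one_satisfies_221)
      fun h => not_starH_unitI_unitI_satisfies_221
        ((Hstar_unitI_unitI_satisfies_iff (.inl rfl) (.inr rfl) (.inr rfl)).1 h)
  have h221 : ∀ {B : AbsoluteValuedAlgebra.{0}}, ¬ B.Satisfies 2 2 1 → ¬ (starH unitI 1).Iso B :=
    not_iso_of_satisfies 2 2 1 starH_unitI_one_satisfies_221
  simp only [List.pairwise_cons, List.mem_cons, List.not_mem_nil, or_false, forall_eq_or_imp,
    forall_eq, IsEmpty.forall_iff, implies_true, List.Pairwise.nil, and_true]
  exact ⟨⟨not_H_one_iso_starHstar _ _, not_H_one_iso_starH _ _, not_H_one_iso_starH _ _,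
      not_H_one_iso_Hstar _ _, not_H_one_iso_Hstar _ _⟩,
    ⟨not_starHstar_one_iso_starH _ _, not_starHstar_one_iso_starH _ _,
      not_starHstar_one_iso_Hstar _ _, not_starHstar_one_iso_Hstar _ _⟩,
    ⟨h221 not_starH_unitI_unitI_satisfies_221, h221 not_Hstar_satisfies_221,
      h221 not_Hstar_satisfies_221⟩,
    ⟨h122, not_starH_unitI_unitI_iso_Hstar⟩, h122'⟩

theorem not_iso_families (α : ℝ) :
    ∀ B ∈ [H 1 1, starHstar 1 1, starH unitI 1, starH unitI unitI, Hstar 1 unitI,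
      Hstar unitI unitI], ¬ B.Iso (starH 1 (expI α)) ∧ ¬ B.Iso (Hstar (expI α) 1) := by
  have h212 : ∀ {B : AbsoluteValuedAlgebra.{0}}, ¬ B.Satisfies 2 1 2 →
      ¬ B.Iso (starH 1 (expI α)) ∧ ¬ B.Iso (Hstar (expI α) 1) := fun hB =>
    ⟨not_iso_of_not_satisfies 2 1 2 hB (starH_one_satisfies_212 _),
      not_iso_of_not_satisfies 2 1 2 hB (Hstar_expI_satisfies_212 α)⟩
  simp only [List.mem_cons, List.not_mem_nil, or_false, forall_eq_or_imp, forall_eq]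
  exact ⟨⟨not_H_one_iso_starH _ _, not_H_one_iso_Hstar _ _⟩,
    ⟨not_starHstar_one_iso_starH _ _, not_starHstar_one_iso_Hstar _ _⟩,
    h212 not_starH_unitI_one_satisfies_212, h212 not_starH_unitI_unitI_satisfies_212,
    h212 fun h => not_starH_unitI_one_satisfies_212
      ((Hstar_one_unitI_satisfies_iff (.inr rfl) (.inl rfl) (.inr rfl)).1 h),
    h212 fun h => not_starH_unitI_unitI_satisfies_212
      ((Hstar_unitI_unitI_satisfies_iff (.inr rfl) (.inl rfl) (.inr rfl)).1 h)⟩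

theorem numIsoClasses_eq_two {p q r : ℕ} {B C : AbsoluteValuedAlgebra.{0}}
    (hB4 : Module.finrank ℝ B = 4) (hC4 : Module.finrank ℝ C = 4) (hBC : ¬ B.Iso C)
    (h : ∀ A : AbsoluteValuedAlgebra.{u}, Module.finrank ℝ A = 4 →
      (A.Satisfies p q r ↔ A.Iso B ∨ A.Iso C))
    (hB : B.Satisfies p q r) (hC : C.Satisfies p q r) : numIsoClasses.{u} p q r = 2 :=
  numIsoClasses_eq ![B, C] (Fin.forall_fin_two.2 ⟨hB4, hC4⟩) (Fin.forall_fin_two.2 ⟨hB, hC⟩)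
    (by simpa [Fin.forall_fin_two] using hBC)
    fun A h4 hA => by simpa [Fin.exists_fin_two] using (h A h4).1 hA

theorem numIsoClasses_eq_three {p q r : ℕ} {B C D : AbsoluteValuedAlgebra.{0}}
    (hB4 : Module.finrank ℝ B = 4) (hC4 : Module.finrank ℝ C = 4) (hD4 : Module.finrank ℝ D = 4)
    (hBC : ¬ B.Iso C) (hBD : ¬ B.Iso D) (hCD : ¬ C.Iso D)
    (h : ∀ A : AbsoluteValuedAlgebra.{u}, Module.finrank ℝ A = 4 →
      (A.Satisfies p q r ↔ A.Iso B ∨ A.Iso C ∨ A.Iso D))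
    (hB : B.Satisfies p q r) (hC : C.Satisfies p q r) (hD : D.Satisfies p q r) :
    numIsoClasses.{u} p q r = 3 := by
  refine numIsoClasses_eq ![B, C, D] ?_ ?_ ?_ fun A h4 hA => ?_
  · intro i; fin_cases i
    exacts [hB4, hC4, hD4]
  · intro i; fin_cases i
    exacts [hB, hC, hD]
  · intro i j hij
    fin_cases i <;> fin_cases j <;> first | exact absurd hij (by decide) | assumption
  · obtain e | e | e := (h A h4).1 hA
    exacts [⟨0, e⟩, ⟨1, e⟩, ⟨2, e⟩]

/-- The angles in `[0, π/2]` give infinitely many pairwise non-isomorphic algebras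
`*ℍ(1,e^{iα})`. -/
theorem numIsoClasses_eq_top_of_starH {p q r : ℕ}
    (h : ∀ b : UnitQuaternion, (starH 1 b).Satisfies p q r) : numIsoClasses.{u} p q r = ⊤ := by
  have : Infinite (Set.Icc (0 : ℝ) (Real.pi / 2)) :=
    (Set.Icc_infinite (by positivity)).to_subtype
  refine numIsoClasses_eq_top (fun α : Set.Icc (0 : ℝ) (Real.pi / 2) => starH 1 (expI α))
    (fun _ => starH_finrank _ _) (fun _ => h _) fun α β hαβ => Subtype.ext ?_
  have hπ := Real.pi_pos
  have hα := α.2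
  have hβ := β.2
  rcases (starH_expI_iso_iff ⟨hα.1, by linarith [hα.2]⟩ ⟨hβ.1, by linarith [hβ.2]⟩).1 hαβ with
    e | e
  · exact e.symm
  · linarith [hα.2, hβ.2]

end PrincipalIsotope
end

open AbsoluteValuedAlgebra PrincipalIsotope in
theorem theorem3p24 :
    -- the table, one identity at a time
    (∀ A : AbsoluteValuedAlgebra.{u}, Module.finrank ℝ A = 4 →
      (A.Satisfies 1 1 1 ↔ A.Iso (H 1 1) ∨ A.Iso (starHstar 1 1)) ∧
      (A.Satisfies 1 2 1 ↔ A.Iso (H 1 1) ∨ A.Iso (starHstar 1 1)) ∧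
      (A.Satisfies 1 1 2 ↔ A.Iso (H 1 1) ∨ A.Iso (Hstar 1 1)) ∧
      (A.Satisfies 1 2 2 ↔
        A.Iso (H 1 1) ∨ A.Iso (Hstar 1 1) ∨ A.Iso (Hstar 1 unitI)) ∧
      (A.Satisfies 2 1 1 ↔ A.Iso (H 1 1) ∨ A.Iso (starH 1 1)) ∧
      (A.Satisfies 2 2 1 ↔
        A.Iso (H 1 1) ∨ A.Iso (starH 1 1) ∨ A.Iso (starH unitI 1)) ∧
      (A.Satisfies 2 1 2 ↔
        A.Iso (H 1 1) ∨ A.Iso (starHstar 1 1) ∨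
        (∃ α ∈ Set.Ico 0 Real.pi, A.Iso (starH 1 (expI α))) ∨
        (∃ α ∈ Set.Ico 0 Real.pi, A.Iso (Hstar (expI α) 1))) ∧
      (A.Satisfies 2 2 2 ↔
        A.Iso (H 1 1) ∨ A.Iso (starHstar 1 1) ∨
        A.Iso (starH unitI 1) ∨ A.Iso (starH unitI unitI) ∨
        A.Iso (Hstar 1 unitI) ∨ A.Iso (Hstar unitI unitI) ∨
        (∃ α ∈ Set.Ico 0 Real.pi, A.Iso (starH 1 (expI α))) ∨
        (∃ α ∈ Set.Ico 0 Real.pi, A.Iso (Hstar (expI α) 1)))) ∧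
    -- the listed algebras outside the two families are pairwise non-isomorphic,
    -- and not isomorphic to any member of the families
    [H 1 1, starHstar 1 1, starH unitI 1, starH unitI unitI, Hstar 1 unitI,
      Hstar unitI unitI].Pairwise (fun B C => ¬ B.Iso C) ∧
    (∀ B ∈ [H 1 1, starHstar 1 1, starH unitI 1, starH unitI unitI, Hstar 1 unitI,
      Hstar unitI unitI], ∀ α ∈ Set.Ico 0 Real.pi,
        ¬ B.Iso (starH 1 (expI α)) ∧ ¬ B.Iso (Hstar (expI α) 1)) ∧
    -- the isomorphisms between members of the two families
    (∀ α ∈ Set.Ico 0 Real.pi, ∀ β ∈ Set.Ico 0 Real.pi,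
      ¬ (starH 1 (expI α)).Iso (Hstar (expI β) 1) ∧
      ((starH 1 (expI α)).Iso (starH 1 (expI β)) ↔ β = α ∨ β = Real.pi - α) ∧
      ((Hstar (expI α) 1).Iso (Hstar (expI β) 1) ↔ β = α ∨ β = Real.pi - α)) ∧
    -- the number of isomorphism classes
    numIsoClasses.{u} 1 1 1 = 2 ∧ numIsoClasses.{u} 1 1 2 = 2 ∧
    numIsoClasses.{u} 1 2 1 = 2 ∧ numIsoClasses.{u} 2 1 1 = 2 ∧
    numIsoClasses.{u} 1 2 2 = 3 ∧ numIsoClasses.{u} 2 2 1 = 3 ∧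
    numIsoClasses.{u} 2 1 2 = ⊤ ∧ numIsoClasses.{u} 2 2 2 = ⊤ := by
  refine ⟨fun A h4 => ⟨satisfies_111_iff A h4, satisfies_121_iff A h4, satisfies_112_iff A h4,
      satisfies_122_iff A h4, satisfies_211_iff A h4, satisfies_221_iff A h4,
      satisfies_212_iff A h4, satisfies_222_iff A h4⟩,
    pairwise_not_iso, fun B hB α _ => not_iso_families α B hB,
    fun α hα β hβ => ⟨not_starH_one_iso_Hstar_one _ _, starH_expI_iso_iff hα hβ,
      Hstar_expI_iso_iff hα hβ⟩, ?_, ?_, ?_, ?_, ?_, ?_,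
    numIsoClasses_eq_top_of_starH starH_one_satisfies_212,
    numIsoClasses_eq_top_of_starH starH_one_satisfies_222⟩
  · exact numIsoClasses_eq_two (H_finrank _ _) (starHstar_finrank _ _)
      (not_H_one_iso_starHstar _ _) satisfies_111_iff (H_one_satisfies _ _ _)
      (starHstar_one_satisfies (.inl rfl) (.inl rfl))
  · exact numIsoClasses_eq_two (H_finrank _ _) (Hstar_finrank _ _)
      (not_H_one_iso_Hstar _ _) satisfies_112_iff (H_one_satisfies _ _ _)
      ((Hstar_one_one_satisfies_iff (.inl rfl) (.inl rfl) (.inr rfl)).2 starH_one_one_satisfies_211)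
  · exact numIsoClasses_eq_two (H_finrank _ _) (starHstar_finrank _ _)
      (not_H_one_iso_starHstar _ _) satisfies_121_iff (H_one_satisfies _ _ _)
      (starHstar_one_satisfies (.inl rfl) (.inr rfl))
  · exact numIsoClasses_eq_two (H_finrank _ _) (starH_finrank _ _)
      (not_H_one_iso_starH _ _) satisfies_211_iff (H_one_satisfies _ _ _)
      starH_one_one_satisfies_211
  · exact numIsoClasses_eq_three (H_finrank _ _) (Hstar_finrank _ _) (Hstar_finrank _ _)
      (not_H_one_iso_Hstar _ _) (not_H_one_iso_Hstar _ _)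
      (not_iso_of_satisfies 1 1 2
        ((Hstar_one_one_satisfies_iff (.inl rfl) (.inl rfl) (.inr rfl)).2
          starH_one_one_satisfies_211)
        fun h => not_starH_unitI_one_satisfies_211
          ((Hstar_one_unitI_satisfies_iff (.inl rfl) (.inl rfl) (.inr rfl)).1 h))
      satisfies_122_iff (H_one_satisfies _ _ _)
      ((Hstar_one_one_satisfies_iff (.inl rfl) (.inr rfl) (.inr rfl)).2 starH_one_one_satisfies_221)
      ((Hstar_one_unitI_satisfies_iff (.inl rfl) (.inr rfl) (.inr rfl)).2
        starH_unitI_one_satisfies_221)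
  · exact numIsoClasses_eq_three (H_finrank _ _) (starH_finrank _ _) (starH_finrank _ _)
      (not_H_one_iso_starH _ _) (not_H_one_iso_starH _ _)
      (not_iso_of_satisfies 2 1 1 starH_one_one_satisfies_211 not_starH_unitI_one_satisfies_211)
      satisfies_221_iff (H_one_satisfies _ _ _) starH_one_one_satisfies_221
      starH_unitI_one_satisfies_221
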